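/- Let $K$ be a field and $A=K[x,y]=\bigoplus_{i\ge 0}A_i$ with the standard grading. For positive integers $a_1,\dots,a_d$ let $R(a_1,\dots,a_d)=K[A_{a_1}s_1,\dots,A_{a_d}s_d]\subset A[s_1,\dots,s_d]$, graded by total degree in $s_1,\dots,s_d$; this is the homogeneous coordinate ring of the rational normal scroll $S(a_1,\dots,a_d)$. We say that $S(b_1,\dots,b_{d-1})$ is a hyperplane section of $S(a_1,\dots,a_d)$ if there is a nonzero element $L$ of degree $1$ in $R(a_1,\dots,a_d)$ such that $R(a_1,\dots,a_d)/(L)\simeq R(b_1,\dots,b_{d-1})$ as graded $K$-algebras. Let $d\ge 1$, and let $a_1\le\dots\le a_d$ and $b_1\le\dots\le b_{d-1}$ be positive integers. Then the following three conditions are equivalent: 1. $S(b_1,\dots,b_{d-1})$ is a hyperplane section of $S(a_1,\dots,a_d)$. 2. There exist $f_1\in A_{a_1},\dots,f_d\in A_{a_d}$ such that the ideal $(f_1,\dots,f_d)$ of $A$ has codimension $2$ and the kernel of the graded $A$-linear map $\bigoplus_{i=1}^d A(-a_i)\to A$, $e_i\mapsto f_i$, is freely generated by homogeneous elements of degrees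 $b_1,\dots,b_{d-1}$. 3. All of the following hold: (i) $a_1+\dots+a_d=b_1+\dots+b_{d-1}$; (ii) $a_j\le b_j$ for every $j=1,\dots,d-1$; (iii) $v=\min\{j : 1\le j\le d-1,\ a_j<b_j\}$ exists, and $b_j\ge a_{j+1}$ for every $j$ with $v\le j\le d-1$. -/

import Mathlib

namespace RationalScroll

open MvPolynomial

/-- The standard graded polynomial ring `A = K[x, y]`. -/
abbrev A (K : Type*) [Field K] := MvPolynomial (Fin 2) K

/-- The polynomial ring `B = A[s_1, …, s_d]`. -/
abbrev B (K : Type*) [Field K] (d : ℕ) := MvPolynomial (Fin d) (A K)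

/-- The homogeneous coordinate ring `R(a_1, …, a_d) = K[A_{a_1} s_1, …, A_{a_d} s_d]` of the
rational normal scroll `S(a_1, …, a_d)`, as a `K`-subalgebra of `B`. -/
noncomputable def scrollRing (K : Type*) [Field K] {d : ℕ} (a : Fin d → ℕ) : Subalgebra K (B K d) :=
  Algebra.adjoin K {p | ∃ (i : Fin d) (f : A K), f.IsHomogeneous (a i) ∧ p = C f * X i}

/-- `r` is homogeneous of degree `m` in the graded `K`-algebra `R(a_1, …, a_d)`: the degree of an
element is its total degree in the variables `s_1, …, s_d`, so that `A_{a_i} s_i` has degree 1. -/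
def IsHomogeneousElem {K : Type*} [Field K] {d : ℕ} {a : Fin d → ℕ} (r : scrollRing K a)
    (m : ℕ) : Prop :=
  (r : B K d).IsHomogeneous m

/-- `S(b)` is a hyperplane section of `S(a)`: there is a nonzero linear form `L` of the homogeneous
coordinate ring of `S(a)` such that the coordinate ring `R(a) / (L)` of the section is isomorphic,
as a graded `K`-algebra, to the homogeneous coordinate ring `R(b)` of `S(b)`. The isomorphism is
given as a surjective graded `K`-algebra map `R(a) → R(b)` with kernel `(L)`. -/
def IsHyperplaneSection (K : Type*) [Field K] {d e : ℕ} (a : Fin d → ℕ) (b : Fin e → ℕ) : Prop :=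
  ∃ L : scrollRing K a, L ≠ 0 ∧ IsHomogeneousElem L 1 ∧
    ∃ φ : scrollRing K a →ₐ[K] scrollRing K b,
      (∀ (m : ℕ) (r : scrollRing K a), IsHomogeneousElem r m → IsHomogeneousElem (φ r) m) ∧
      Function.Surjective φ ∧ RingHom.ker φ = Ideal.span {L}

/-- `h` is homogeneous of degree `c` in the graded free module `F = A(-a_1) ⊕ … ⊕ A(-a_d)`, i.e.
its `i`-th coordinate lies in `A_{c - a_i}`, which is zero if `c < a_i`. -/
def IsHomogeneousVec {K : Type*} [Field K] {d : ℕ} (a : Fin d → ℕ) (h : Fin d → A K)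
    (c : ℕ) : Prop :=
  ∀ i, (a i ≤ c → (h i).IsHomogeneous (c - a i)) ∧ (c < a i → h i = 0)

/-- The graded `A`-linear map `Φ : A(-a_1) ⊕ … ⊕ A(-a_d) → A` with `Φ(e_i) = f_i`. -/
noncomputable def syzygyMap {K : Type*} [Field K] {d : ℕ} (f : Fin d → A K) :
    (Fin d → A K) →ₗ[A K] A K :=
  Fintype.linearCombination (A K) f

/-- There are forms `f_i ∈ A_{a_i}` generating an ideal of codimension 2 whose syzygy module
`ker Φ` is freely generated by homogeneous elements of degrees `b_1, b_2, …`. -/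
def OccursAsSyzygyDegrees (K : Type*) [Field K] {d e : ℕ} (a : Fin d → ℕ) (b : Fin e → ℕ) : Prop :=
  ∃ f : Fin d → A K, (∀ i, (f i).IsHomogeneous (a i)) ∧
    (Ideal.span (Set.range f)).height = 2 ∧
    ∃ g : Fin e → (Fin d → A K), (∀ j, IsHomogeneousVec a (g j) (b j)) ∧
      LinearIndependent (A K) g ∧
      Submodule.span (A K) (Set.range g) = LinearMap.ker (syzygyMap f)

/-- The three numerical conditions on `a_1, …, a_{n+1}` and `b_1, …, b_n`. -/
def NumericalConditions {n : ℕ} (a : Fin (n + 1) → ℕ) (b : Fin n → ℕ) : Prop :=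
  ∑ i, a i = ∑ j, b j ∧
  (∀ j : Fin n, a j.castSucc ≤ b j) ∧
  ∃ v : Fin n, IsLeast {j : Fin n | a j.castSucc < b j} v ∧ ∀ j, v ≤ j → a j.succ ≤ b j

end RationalScroll

/-!
The three conditions are shown equivalent by going around the cycle
hyperplane section ⇒ numerical conditions ⇒ syzygy degrees ⇒ hyperplane section.

*Hyperplane sections satisfy the numerical conditions*
(`numericalConditions_of_isHyperplaneSection`). A graded surjection `φ : R(a) → R(b)` with kernel
`(L)` is, in degree one, a surjection of `K`-vector spaces `⊕ A_{a_i} s_i → ⊕ A_{b_j} t_j` with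
one-dimensional kernel, so `Σ a = Σ b`. The quadrics
`(x^{p+1} y^q s_i) (x^{p'} y^{q'+1} s_{i'}) = (x^p y^{q+1} s_i) (x^{p'+1} y^{q'} s_{i'})`
are preserved by `φ`, and `A[t]` is factorial, so the images of the `x^{a_i-k} y^k s_i` are
`α^{a_i-k} β^k w_i` with `α, β` coprime and common to all `i` (`exists_imageMonomial_eq`). The
dimension of the kernel forces `α, β` to lie in `A` (`totalDegree_eq_zero_of_imageMonomial_eq`) and
not to be both constant; then the image of `A_{a_i} s_i` involves `t_j` only if `a_i ≤ b_j`
(`le_of_coeff_imageMonomial_ne_zero`). Whenever `b_j < a_i` for all `i ∉ I` and `j ∈ J`, this gives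
a surjection from `⊕_{i ∈ I} A_{a_i}` to `⊕_{j ∈ J} A_{b_j}`; comparing dimensions for initial
segments `I` and `J` yields the remaining conditions (`numericalConditions_of_rank_le`).

*The numerical conditions give syzygies* (`occursAsSyzygyDegrees_of_numericalConditions`). The rows
`g_j = x^{b_j - a_j} e_j - y^{b_j - a_{j+1}} e_{j+1}` (without the second term for `j < v`, where
`b_j = a_j`) form a basis of the syzygies of monomials `f_v, …, f_d` with `f_v = y^{a_v}` and
`f_d = x^{a_d}`, the other `f_i` being zero.

*Syzygies give hyperplane sections* (`isHyperplaneSection_of_occursAsSyzygyDegrees`). Take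
`L = Σ f_i s_i` and the substitution `s_i ↦ Σ_j g_{ji} t_j`. Height two means that the `f_i` have
no common prime factor. By the Hilbert–Burch theorem (`exists_isUnit_det_borderedMatrix_eq`) the
maximal minors of `g` are, up to a unit, the `f_i`; their degrees give `Σ a = Σ b`. The adjugate of
`g` bordered by a unit vector inverts the substitution modulo `L` up to the factor `f_k`, so that
`L` divides `f_k^m F` for every `F` of degree `m` in the kernel and every `k`, hence divides `F`
(`linearForm_dvd`). Thus the kernel on `R(a)` is `(L)`, in degree one it is the line `K·L`, and a
dimension count shows that the map is onto in degree one, hence onto.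
-/

namespace RationalScroll

open MvPolynomial

/-! ### Homogeneous components and the coordinate ring -/

/-- Multiplication by a form of degree `a` shifts homogeneous components by `a`. -/
lemma homogeneousComponent_mul_left {σ R : Type*} [CommSemiring R] {f : MvPolynomial σ R} {a : ℕ}
    (hf : f.IsHomogeneous a) (k : ℕ) (c : MvPolynomial σ R) :
    homogeneousComponent (a + k) (f * c) = f * homogeneousComponent k c := by
  conv_lhs => rw [← sum_homogeneousComponent c, Finset.mul_sum, map_sum]
  have h : ∀ i, homogeneousComponent (a + k) (f * homogeneousComponent i c)
      = if k = i then f * homogeneousComponent i c else 0 := by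
    intro i
    rw [homogeneousComponent_of_mem (hf.mul (homogeneousComponent_isHomogeneous i c))]
    simp
  simp only [h]
  rw [Finset.sum_ite_eq]
  split_ifs with hk
  · rfl
  · rw [homogeneousComponent_eq_zero, mul_zero]
    simpa using hk

lemma exists_eq_single_of_degree_eq_one {ι : Type*} {m : ι →₀ ℕ} (h : m.degree = 1) :
    ∃ i, m = Finsupp.single i 1 := by
  classical
  have hne : m ≠ 0 := by rintro rfl; simp at h
  obtain ⟨i, hi⟩ := Finsupp.support_nonempty_iff.mpr hne
  have hle : Finsupp.single i 1 ≤ m := by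
    rw [Finsupp.single_le_iff]
    have := Finsupp.mem_support_iff.mp hi
    omega
  obtain ⟨m', rfl⟩ := exists_add_of_le hle
  refine ⟨i, ?_⟩
  rw [map_add, Finsupp.degree_single] at h
  have : m' = 0 := (Finsupp.degree_eq_zero_iff m').mp (by omega)
  simp [this]

section CoordinateRing
variable {K : Type*} [Field K] {d : ℕ} {a : Fin d → ℕ}

/-- The bidegree condition on the coefficient of a monomial forces the corresponding term to lie
in the subalgebra generated by the `A_{a_i} s_i`: a monomial in `x, y` of degree `Σ m_i a_i` is a
product of monomials of the degrees `a_i`. -/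
lemma monomial_mem_scrollRing (N : ℕ) : ∀ (m : Fin d →₀ ℕ), m.degree = N →
    ∀ (e : Fin 2 →₀ ℕ) (c : K), e.degree = ∑ i, m i * a i →
    (monomial m (monomial e c) : B K d) ∈ scrollRing K a := by
  classical
  induction N with
  | zero =>
    intro m hm e c he
    obtain rfl : m = 0 := (Finsupp.degree_eq_zero_iff m).mp hm
    obtain rfl : e = 0 := (Finsupp.degree_eq_zero_iff e).mp (by simpa using he)
    exact (scrollRing K a).algebraMap_mem c
  | succ N ih =>
    intro m hm e c he
    have hne : m ≠ 0 := by rintro rfl; simp at hm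
    obtain ⟨i, hi⟩ := Finsupp.support_nonempty_iff.mpr hne
    have hle : Finsupp.single i 1 ≤ m := by
      rw [Finsupp.single_le_iff]
      have := Finsupp.mem_support_iff.mp hi
      omega
    obtain ⟨m', rfl⟩ := exists_add_of_le hle
    have hsum : ∑ j, (Finsupp.single i 1 + m' : Fin d →₀ ℕ) j * a j = a i + ∑ j, m' j * a j := by
      simp [add_mul, Finset.sum_add_distrib, Finsupp.single_apply]
    rw [hsum] at he
    rw [Finsupp.degree_eq_sum, Fin.sum_univ_two] at he
    set e₁ : Fin 2 →₀ ℕ :=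
      Finsupp.single 0 (min (a i) (e 0)) + Finsupp.single 1 (a i - min (a i) (e 0)) with he₁
    have hle₁ : e₁ ≤ e := by
      intro t
      fin_cases t
      · simp [he₁]
      · simp [he₁]; omega
    have hd₁ : e₁.degree = a i := by
      rw [he₁, map_add, Finsupp.degree_single, Finsupp.degree_single]; omega
    clear_value e₁
    clear he₁
    obtain ⟨e₂, rfl⟩ := exists_add_of_le hle₁
    have hd₂ : e₂.degree = ∑ j, m' j * a j := by
      rw [Finsupp.degree_eq_sum, Fin.sum_univ_two] at hd₁ ⊢
      simp only [Finsupp.add_apply] at he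
      omega
    have hmem₁ : (C (monomial e₁ (1 : K)) * X i : B K d) ∈ scrollRing K a :=
      Algebra.subset_adjoin ⟨i, _, isHomogeneous_monomial _ hd₁, rfl⟩
    have hmem₂ := ih m' (by rw [map_add, Finsupp.degree_single] at hm; omega) e₂ c hd₂
    have := (scrollRing K a).mul_mem hmem₁ hmem₂
    rwa [C_mul_X_eq_monomial, monomial_mul, monomial_mul, one_mul] at this

/-- `R(a)` is the part of `A[s]` of degree zero for the grading `deg x = deg y = 1`,
`deg s_i = -a_i`. -/
lemma mem_scrollRing_iff {r : B K d} :
    r ∈ scrollRing K a ↔ ∀ m : Fin d →₀ ℕ, (coeff m r).IsHomogeneous (∑ i, m i * a i) := by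
  classical
  constructor
  · intro hr
    refine Algebra.adjoin_induction (p := fun r _ => ∀ m : Fin d →₀ ℕ,
      (coeff m r).IsHomogeneous (∑ i, m i * a i)) ?_ ?_ ?_ ?_ hr
    · rintro _ ⟨i, f, hf, rfl⟩ m
      rw [C_mul_X_eq_monomial, coeff_monomial]
      split_ifs with h
      · subst h
        simpa [Finsupp.single_apply] using hf
      · exact isHomogeneous_zero _ _ _
    · intro c m
      change (coeff m (C (C c) : B K d)).IsHomogeneous _
      rw [coeff_C]
      split_ifs with h
      · subst h
        simpa using isHomogeneous_C _ c
      · exact isHomogeneous_zero _ _ _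
    · intro r s _ _ hr hs m
      rw [coeff_add]
      exact (hr m).add (hs m)
    · intro r s _ _ hr hs m
      rw [coeff_mul]
      refine IsHomogeneous.sum _ _ _ fun p hp => ?_
      have := (hr p.1).mul (hs p.2)
      rw [← Finset.sum_add_distrib] at this
      rw [Finset.HasAntidiagonal.mem_antidiagonal] at hp
      simpa [← hp, add_mul] using this
  · intro h
    rw [r.as_sum]
    refine Subalgebra.sum_mem _ fun m _ => ?_
    rw [(coeff m r).as_sum, map_sum]
    refine Subalgebra.sum_mem _ fun e he => ?_
    refine monomial_mem_scrollRing _ m rfl e _ ?_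
    have := (h m).degree_eq_sum_deg_support he
    rw [this, Finsupp.degree_apply]

lemma homogeneousComponent_mem_scrollRing {r : B K d} (hr : r ∈ scrollRing K a) (k : ℕ) :
    homogeneousComponent k r ∈ scrollRing K a := by
  rw [mem_scrollRing_iff] at hr ⊢
  intro m
  rw [coeff_homogeneousComponent]
  split_ifs
  · exact hr m
  · exact isHomogeneous_zero _ _ _

/-- In degree one, the ideal generated by a linear form `L` of `R(a)` is the line `K·L`. -/
lemma exists_eq_smul_of_eq_mul {L q r : B K d} (hL : L.IsHomogeneous 1)
    (hr : r.IsHomogeneous 1) (hq : q ∈ scrollRing K a) (h : r = L * q) :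
    ∃ c : K, r = c • L := by
  have h1 := homogeneousComponent_mul_left hL 0 q
  rw [← h, add_zero, homogeneousComponent_eq_self hr, homogeneousComponent_zero] at h1
  have h0 := mem_scrollRing_iff.mp hq 0
  simp only [Finsupp.coe_zero, Pi.zero_apply, zero_mul, Finset.sum_const_zero] at h0
  obtain ⟨c, hc⟩ : ∃ c, coeff 0 q = C c :=
    ⟨_, totalDegree_eq_zero_iff_eq_C.mp (Nat.le_zero.mp h0.totalDegree_le)⟩
  refine ⟨c, ?_⟩
  rw [h1, hc, mul_comm, Algebra.smul_def]
  rfl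

/-! ### Coordinates on the linear forms of the coordinate ring -/

/-- The basis `x^(a_i - k) y^k s_i` of the linear forms of `R(a)`. -/
noncomputable def linearMonomial (K : Type*) [Field K] {d : ℕ} (a : Fin d → ℕ)
    (s : Σ i, Fin (a i + 1)) : B K d :=
  C (X 0 ^ (a s.1 - s.2) * X 1 ^ (s.2 : ℕ)) * X s.1

/-- The linear form of `R(a)` with prescribed coordinates. -/
noncomputable def ofCoords (K : Type*) [Field K] {d : ℕ} (a : Fin d → ℕ) :
    ((Σ i, Fin (a i + 1)) → K) →ₗ[K] B K d :=
  Fintype.linearCombination K (linearMonomial K a)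

/-- The coordinates of a linear form of `R(a)` with respect to `linearMonomial`. -/
noncomputable def coords (K : Type*) [Field K] {d : ℕ} (a : Fin d → ℕ) :
    B K d →ₗ[K] ((Σ i, Fin (a i + 1)) → K) where
  toFun r s := coeff (Finsupp.single 0 (a s.1 - s.2) + Finsupp.single 1 (s.2 : ℕ))
    (coeff (Finsupp.single s.1 1) r)
  map_add' r r' := by ext; simp
  map_smul' c r := by ext; simp

lemma X_pow_mul_X_pow (p q : ℕ) : (X 0 ^ p * X 1 ^ q : A K) =
    monomial (Finsupp.single 0 p + Finsupp.single 1 q) 1 := by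
  rw [X_pow_eq_monomial, X_pow_eq_monomial, monomial_mul, one_mul]

lemma isHomogeneous_X_pow_mul_X_pow (p q : ℕ) :
    (X 0 ^ p * X 1 ^ q : A K).IsHomogeneous (p + q) :=
  (isHomogeneous_X_pow 0 p).mul (isHomogeneous_X_pow 1 q)

lemma linearMonomial_mem (s : Σ i, Fin (a i + 1)) : linearMonomial K a s ∈ scrollRing K a := by
  refine Algebra.subset_adjoin ⟨s.1, _, ?_, rfl⟩
  have := isHomogeneous_X_pow_mul_X_pow (K := K) (a s.1 - s.2) s.2
  rwa [Nat.sub_add_cancel (Nat.lt_succ_iff.mp s.2.2)] at this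

lemma linearMonomial_isHomogeneous (s : Σ i, Fin (a i + 1)) :
    (linearMonomial K a s).IsHomogeneous 1 := isHomogeneous_C_mul_X _ _

lemma ofCoords_apply (c : (Σ i, Fin (a i + 1)) → K) :
    ofCoords K a c = ∑ s, c s • linearMonomial K a s := rfl

lemma ofCoords_mem (c : (Σ i, Fin (a i + 1)) → K) : ofCoords K a c ∈ scrollRing K a := by
  rw [ofCoords_apply]
  exact Subalgebra.sum_mem _ fun s _ => Subalgebra.smul_mem _ (linearMonomial_mem s) _

lemma ofCoords_isHomogeneous (c : (Σ i, Fin (a i + 1)) → K) :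
    (ofCoords K a c).IsHomogeneous 1 := by
  rw [ofCoords_apply]
  refine IsHomogeneous.sum _ _ _ fun s _ => ?_
  rw [Algebra.smul_def]
  exact (linearMonomial_isHomogeneous s).C_mul (C (c s))

lemma coords_linearMonomial (s t : Σ i, Fin (a i + 1)) :
    coords K a (linearMonomial K a s) t = if s = t then 1 else 0 := by
  classical
  obtain ⟨i, k⟩ := s
  obtain ⟨j, l⟩ := t
  simp only [coords, linearMonomial, LinearMap.coe_mk, AddHom.coe_mk, C_mul_X_eq_monomial,
    coeff_monomial, X_pow_mul_X_pow]
  by_cases hij : i = j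
  · subst hij
    rw [if_pos rfl, coeff_monomial]
    refine if_congr ⟨fun h => ?_, fun h => ?_⟩ rfl rfl
    · have := DFunLike.congr_fun h 1
      simp at this
      simpa using Fin.ext this
    · simp at h
      rw [h]
  · rw [if_neg, if_neg, coeff_zero]
    · rintro h; exact hij (congrArg Sigma.fst h)
    · rintro h; exact hij (Finsupp.single_left_injective one_ne_zero h)

lemma coords_ofCoords (c : (Σ i, Fin (a i + 1)) → K) : coords K a (ofCoords K a c) = c := by
  ext t
  rw [ofCoords_apply, map_sum, Finset.sum_apply]
  simp only [map_smul, Pi.smul_apply, coords_linearMonomial, smul_eq_mul]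
  simp

lemma coords_injOn {r r' : B K d} (hr : r ∈ scrollRing K a) (hr' : r' ∈ scrollRing K a)
    (h1 : r.IsHomogeneous 1) (h1' : r'.IsHomogeneous 1) (h : coords K a r = coords K a r') :
    r = r' := by
  ext1 m
  by_cases hm : m.degree = 1
  · obtain ⟨i, rfl⟩ := exists_eq_single_of_degree_eq_one hm
    have hw : ∑ j, (Finsupp.single i 1 : Fin d →₀ ℕ) j * a j = a i := by
      simp [Finsupp.single_apply]
    have H := mem_scrollRing_iff.mp hr (Finsupp.single i 1)
    have H' := mem_scrollRing_iff.mp hr' (Finsupp.single i 1)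
    rw [hw] at H H'
    ext1 e
    by_cases he : e.degree = a i
    · have hd : e 0 + e 1 = a i := by rwa [Finsupp.degree_eq_sum, Fin.sum_univ_two] at he
      have key := congrFun h ⟨i, ⟨e 1, by omega⟩⟩
      have hee : Finsupp.single 0 (a i - e 1) + Finsupp.single 1 (e 1) = e := by
        ext t
        fin_cases t
        · simp; omega
        · simp
      simp only [coords, LinearMap.coe_mk, AddHom.coe_mk, hee] at key
      exact key
    · rw [H.coeff_eq_zero he, H'.coeff_eq_zero he]
  · rw [h1.coeff_eq_zero hm, h1'.coeff_eq_zero hm]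

lemma ofCoords_coords {r : B K d} (hr : r ∈ scrollRing K a) (h1 : r.IsHomogeneous 1) :
    ofCoords K a (coords K a r) = r :=
  coords_injOn (ofCoords_mem _) hr (ofCoords_isHomogeneous _) h1 (coords_ofCoords _)

lemma card_sigma_filter (I : Finset (Fin d)) :
    (I.sigma fun i => (Finset.univ : Finset (Fin (a i + 1)))).card = ∑ i ∈ I, (a i + 1) := by
  simp

/-! ### Maps between coordinate rings in degree one -/

variable {e : ℕ} {b : Fin e → ℕ}

/-- The matrix of a map `R(a) → R(b)` on linear forms. -/
noncomputable def degreeOneMap (φ : scrollRing K a →ₐ[K] scrollRing K b) :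
    ((Σ i, Fin (a i + 1)) → K) →ₗ[K] ((Σ j, Fin (b j + 1)) → K) where
  toFun c := coords K b (φ ⟨ofCoords K a c, ofCoords_mem c⟩ : scrollRing K b)
  map_add' c c' := by
    rw [← map_add, ← Subalgebra.coe_add, ← map_add]
    congr 3
    ext1
    simp
  map_smul' c c' := by
    rw [RingHom.id_apply, ← map_smul, ← Subalgebra.coe_smul, ← map_smul]
    congr 3
    ext1
    simp

/-- The map `φ` of coordinate rings preserves the grading. -/
def IsGraded (φ : scrollRing K a →ₐ[K] scrollRing K b) : Prop :=
  ∀ (m : ℕ) (r : scrollRing K a), IsHomogeneousElem r m → IsHomogeneousElem (φ r) m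

lemma degreeOneMap_eq_zero_iff {φ : scrollRing K a →ₐ[K] scrollRing K b} (hφ : IsGraded φ)
    (c : (Σ i, Fin (a i + 1)) → K) :
    degreeOneMap φ c = 0 ↔ φ ⟨ofCoords K a c, ofCoords_mem c⟩ = 0 := by
  constructor
  · intro h
    ext1
    refine coords_injOn (SetLike.coe_mem _) (SetLike.coe_mem _)
      (hφ 1 _ (ofCoords_isHomogeneous c)) (isHomogeneous_zero _ _ _) ?_
    rw [ZeroMemClass.coe_zero, map_zero]
    exact h
  · intro h
    change coords K b (φ ⟨ofCoords K a c, ofCoords_mem c⟩ : scrollRing K b) = 0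
    rw [h, ZeroMemClass.coe_zero, map_zero]

/-- The linear forms killed by `φ` form the line through `L`. -/
lemma ker_degreeOneMap {φ : scrollRing K a →ₐ[K] scrollRing K b} (hφ : IsGraded φ)
    {L : scrollRing K a} (hL0 : L ≠ 0) (hL : IsHomogeneousElem L 1)
    (hker : RingHom.ker φ = Ideal.span {L}) :
    Module.finrank K (LinearMap.ker (degreeOneMap φ)) = 1 := by
  have hLc : ofCoords K a (coords K a (L : B K d)) = L := ofCoords_coords L.2 hL
  have hmem : coords K a (L : B K d) ∈ LinearMap.ker (degreeOneMap φ) := by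
    rw [LinearMap.mem_ker, degreeOneMap_eq_zero_iff hφ]
    have : L ∈ RingHom.ker φ := by rw [hker]; exact Ideal.mem_span_singleton_self L
    convert (RingHom.mem_ker).mp this
  refine finrank_eq_one ⟨_, hmem⟩ ?_ ?_
  · intro h
    have : coords K a (L : B K d) = 0 := congrArg Subtype.val h
    rw [this, map_zero] at hLc
    exact hL0 (Subtype.ext hLc.symm)
  · rintro ⟨c, hc⟩
    rw [LinearMap.mem_ker, degreeOneMap_eq_zero_iff hφ, ← RingHom.mem_ker, hker,
      Ideal.mem_span_singleton] at hc
    obtain ⟨q, hq⟩ := hc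
    have hq' : ofCoords K a c = (L : B K d) * (q : B K d) := congrArg Subtype.val hq
    obtain ⟨t, ht⟩ := exists_eq_smul_of_eq_mul hL (ofCoords_isHomogeneous c) q.2 hq'
    refine ⟨t, Subtype.ext ?_⟩
    change t • coords K a (L : B K d) = c
    rw [← map_smul, ← ht, coords_ofCoords]

/-- A graded map which is onto is onto in degree one. -/
lemma degreeOneMap_surjective {φ : scrollRing K a →ₐ[K] scrollRing K b} (hφ : IsGraded φ)
    (hs : Function.Surjective φ) : Function.Surjective (degreeOneMap φ) := by
  intro c
  obtain ⟨r, hr⟩ := hs ⟨ofCoords K b c, ofCoords_mem c⟩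
  let comp : ℕ → scrollRing K a := fun k =>
    ⟨homogeneousComponent k (r : B K d), homogeneousComponent_mem_scrollRing r.2 k⟩
  have hsum : r = ∑ k ∈ Finset.range ((r : B K d).totalDegree + 1), comp k := by
    ext1
    rw [AddSubmonoidClass.coe_finsetSum]
    exact (sum_homogeneousComponent _).symm
  have hcomp : ∀ k, ((φ (comp k) : scrollRing K b) : B K e).IsHomogeneous k := fun k =>
    hφ k _ (homogeneousComponent_isHomogeneous k _)
  have h1 : ofCoords K b c = φ (comp 1) := by
    have h := congrArg (fun z : scrollRing K b => homogeneousComponent 1 (z : B K e)) hr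
    simp only at h
    rw [homogeneousComponent_eq_self (ofCoords_isHomogeneous c), hsum, map_sum,
      AddSubmonoidClass.coe_finsetSum, map_sum] at h
    rw [← h]
    have : ∀ k, homogeneousComponent 1 ((φ (comp k) : scrollRing K b) : B K e) =
        if 1 = k then ((φ (comp k) : scrollRing K b) : B K e) else 0 := fun k =>
      homogeneousComponent_of_mem (hcomp k)
    simp only [this]
    rw [Finset.sum_ite_eq]
    split_ifs with hk
    · rfl
    · have : comp 1 = 0 := by
        ext1
        exact homogeneousComponent_eq_zero _ _ (by simpa using hk)
      rw [this, map_zero, ZeroMemClass.coe_zero]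
  refine ⟨coords K a (comp 1 : B K d), ?_⟩
  change coords K b (φ ⟨ofCoords K a (coords K a (comp 1 : B K d)), _⟩ : scrollRing K b) = c
  have : (⟨ofCoords K a (coords K a (comp 1 : B K d)), ofCoords_mem _⟩ : scrollRing K a) = comp 1 :=
    Subtype.ext (ofCoords_coords (comp 1).2 (homogeneousComponent_isHomogeneous 1 _))
  rw [this, ← h1, coords_ofCoords]

end CoordinateRing

/-! ### Numerical conditions from rank inequalities -/

/-- If `T` is onto and the coordinates in `S'` of its values only depend on the coordinates in `S`
of the argument, then `#S' ≤ #S`. -/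
lemma card_le_of_surjective_of_support {ι κ K : Type*} [Field K] [Fintype ι] [DecidableEq ι]
    [DecidableEq κ] (T : (ι → K) →ₗ[K] (κ → K)) (hT : Function.Surjective T) (S : Finset ι)
    (S' : Finset κ) (h : ∀ s ∉ S, ∀ t ∈ S', T (Pi.single s 1) t = 0) : S'.card ≤ S.card := by
  let T' : (S → K) →ₗ[K] (S' → K) :=
    (LinearMap.funLeft K K (Subtype.val : S' → κ)) ∘ₗ T ∘ₗ
      (Fintype.linearCombination K fun s : S => (Pi.single s.1 1 : ι → K))
  have hT' : Function.Surjective T' := by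
    intro y
    obtain ⟨c, hc⟩ := hT fun t => if ht : t ∈ S' then y ⟨t, ht⟩ else 0
    refine ⟨fun s => c s, ?_⟩
    ext ⟨t, ht⟩
    have h1 : T c t = y ⟨t, ht⟩ := by rw [hc]; simp [ht]
    have h2 : c = ∑ s, c s • (Pi.single s 1 : ι → K) := by
      ext i
      simp [Finset.sum_apply, Pi.single_apply]
    have h3 : T c t = ∑ s, c s * T (Pi.single s 1) t := by
      conv_lhs => rw [h2]
      simp
    have h4 : ∑ s, c s * T (Pi.single s 1) t = ∑ s ∈ S, c s * T (Pi.single s 1) t := by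
      symm
      refine Finset.sum_subset (Finset.subset_univ _) fun s _ hs => ?_
      rw [h s hs t ht, mul_zero]
    rw [← h1, h3, h4, ← Finset.sum_coe_sort]
    simp [T', Fintype.linearCombination_apply, LinearMap.funLeft_apply]
  simpa using LinearMap.finrank_le_finrank_of_surjective hT'

/-- The numerical conditions follow from `Σ a = Σ b` and the rank inequalities that a surjection
`⊕ A_{a_i} s_i → ⊕ A_{b_j} t_j` forces when `s_i` cannot contribute to `t_j` unless
`a_i ≤ b_j`. -/
lemma numericalConditions_of_rank_le {n : ℕ} {a : Fin (n + 1) → ℕ} {b : Fin n → ℕ}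
    (ha_pos : ∀ i, 0 < a i) (ha : Monotone a) (hb : Monotone b) (hsum : ∑ i, a i = ∑ j, b j)
    (h : ∀ (I : Finset (Fin (n + 1))) (J : Finset (Fin n)), (∀ i ∉ I, ∀ j ∈ J, b j < a i) →
      ∑ j ∈ J, (b j + 1) ≤ ∑ i ∈ I, (a i + 1)) : NumericalConditions a b := by
  have h2 : ∀ j : Fin n, a j.castSucc ≤ b j := by
    intro j
    induction j using WellFoundedLT.induction with
    | ind j ih =>
    by_contra! hlt
    -- For the least `j` with `b_j < a_j`, the forms `t_k` with `k ≤ j` only receive the `s_i` with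
    -- `i < j`.
    have key := h ((Finset.Iio j).map Fin.castSuccEmb) (Finset.Iic j) ?_
    · rw [Finset.sum_map, ← Finset.Iio_insert, Finset.sum_insert (by simp)] at key
      have : ∑ i ∈ Finset.Iio j, (a (Fin.castSuccEmb i) + 1) ≤ ∑ i ∈ Finset.Iio j, (b i + 1) :=
        Finset.sum_le_sum fun i hi => Nat.succ_le_succ (ih i (Finset.mem_Iio.mp hi))
      omega
    · intro i hi k hk
      refine (hb (Finset.mem_Iic.mp hk)).trans_lt (hlt.trans_le (ha ?_))
      by_contra! hlt'
      refine hi (Finset.mem_map.mpr ⟨i.castPred (Fin.ne_last_of_lt hlt'), ?_, by simp⟩)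
      rw [Finset.mem_Iio]
      exact (Fin.castPred_lt_iff _).mpr hlt'
  refine ⟨hsum, h2, ?_⟩
  have hne : {j : Fin n | a j.castSucc < b j}.Nonempty := by
    by_contra hempty
    rw [Set.not_nonempty_iff_eq_empty, Set.eq_empty_iff_forall_notMem] at hempty
    have : ∑ j, b j ≤ ∑ j : Fin n, a j.castSucc :=
      Finset.sum_le_sum fun j _ => not_lt.mp (hempty j)
    rw [Fin.sum_univ_castSucc] at hsum
    have := ha_pos (Fin.last n)
    omega
  have hv := WellFounded.min_mem (wellFounded_lt (α := Fin n)) _ hne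
  set v := WellFounded.min (wellFounded_lt (α := Fin n)) _ hne with hv'
  have hleast : IsLeast {j : Fin n | a j.castSucc < b j} v :=
    ⟨hv, fun j hj => not_lt.mp (WellFounded.not_lt_min _ _ hj)⟩
  refine ⟨v, hleast, fun j hj => ?_⟩
  by_contra! hlt
  -- If `b_j < a_{j+1}`, then `t_1, …, t_j` only receive `s_1, …, s_j`, which have too small a rank
  -- because `a_v < b_v`.
  have key := h ((Finset.Iic j).map Fin.castSuccEmb) (Finset.Iic j) ?_
  · rw [Finset.sum_map] at key
    have : ∑ i ∈ Finset.Iic j, (a (Fin.castSuccEmb i) + 1) < ∑ i ∈ Finset.Iic j, (b i + 1) :=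
      Finset.sum_lt_sum (fun i _ => Nat.succ_le_succ (h2 i))
        ⟨v, Finset.mem_Iic.mpr hj, Nat.succ_lt_succ hv⟩
    omega
  · intro i hi k hk
    refine (hb (Finset.mem_Iic.mp hk)).trans_lt (hlt.trans_le (ha ?_))
    by_contra! hlt'
    refine hi (Finset.mem_map.mpr ⟨i.castPred (Fin.ne_last_of_lt hlt'), ?_, by simp⟩)
    rw [Finset.mem_Iic, Fin.castPred_le_iff]
    exact Fin.le_castSucc_iff.mpr hlt'

/-! ### Matrices of rank one over a factorial domain -/

/-- A sequence with constant ratio `β / α` in lowest terms is geometric. -/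
lemma exists_eq_pow_mul_pow_mul {R : Type*} [CommRing R] [IsDomain R] [DecompositionMonoid R]
    {α β : R} (hαβ : IsRelPrime α β) (u : ℕ → R) (N : ℕ) (h : ∀ k < N, α * u (k + 1) = β * u k) :
    ∃ w, ∀ k ≤ N, u k = α ^ (N - k) * β ^ k * w := by
  induction N with
  | zero => exact ⟨u 0, fun k hk => by simp [Nat.le_zero.mp hk]⟩
  | succ N ih =>
    obtain ⟨w, hw⟩ := ih fun k hk => h k (by omega)
    have hN := h N (by omega)
    rw [hw N le_rfl, Nat.sub_self, pow_zero, one_mul, ← mul_assoc, ← pow_succ'] at hN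
    by_cases hα : α = 0
    · subst hα
      have hβ : IsUnit β := isRelPrime_zero_left.mp hαβ
      obtain ⟨γ, hγ⟩ := (hβ.pow (N + 1)).exists_right_inv
      have hw0 : w = 0 := by
        rw [zero_mul] at hN
        exact ((mul_eq_zero.mp hN.symm).resolve_left (hβ.pow _).ne_zero)
      refine ⟨γ * u (N + 1), fun k hk => ?_⟩
      rcases Nat.lt_or_ge k (N + 1) with hk' | hk'
      · rw [hw k (by omega), hw0, mul_zero, zero_pow (show N + 1 - k ≠ 0 by omega), zero_mul,
          zero_mul]
      · obtain rfl : k = N + 1 := by omega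
        rw [Nat.sub_self, pow_zero, one_mul, ← mul_assoc, hγ, one_mul]
    · obtain ⟨w', rfl⟩ : α ∣ w :=
        (hαβ.pow_right (n := N + 1)).dvd_of_dvd_mul_left ⟨_, hN.symm⟩
      refine ⟨w', fun k hk => ?_⟩
      rcases Nat.lt_or_ge k (N + 1) with hk' | hk'
      · rw [hw k (by omega), show N + 1 - k = (N - k) + 1 by omega]
        ring
      · obtain rfl : k = N + 1 := by omega
        apply mul_left_cancel₀ hα
        rw [hN]
        simp
        ring

section ImageMonomial
variable {K : Type*} [Field K] {d e : ℕ} {a : Fin d → ℕ} {b : Fin e → ℕ}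

/-- The image of a basis element `x^(a_i - k) y^k s_i` under a map of coordinate rings. -/
noncomputable def imageMonomial (φ : scrollRing K a →ₐ[K] scrollRing K b)
    (s : Σ i, Fin (a i + 1)) : B K e :=
  φ ⟨linearMonomial K a s, linearMonomial_mem s⟩

lemma coe_map_ofCoords (φ : scrollRing K a →ₐ[K] scrollRing K b)
    (c : (Σ i, Fin (a i + 1)) → K) :
    (φ ⟨ofCoords K a c, ofCoords_mem c⟩ : B K e) = ∑ s, c s • imageMonomial φ s := by
  have : (⟨ofCoords K a c, ofCoords_mem c⟩ : scrollRing K a) =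
      ∑ s, c s • ⟨linearMonomial K a s, linearMonomial_mem s⟩ := by
    ext1
    rw [AddSubmonoidClass.coe_finsetSum]
    rfl
  rw [this, map_sum, AddSubmonoidClass.coe_finsetSum]
  refine Finset.sum_congr rfl fun s _ => ?_
  rw [map_smul]
  rfl

lemma degreeOneMap_eq_zero_iff_sum {φ : scrollRing K a →ₐ[K] scrollRing K b} (hφ : IsGraded φ)
    (c : (Σ i, Fin (a i + 1)) → K) :
    degreeOneMap φ c = 0 ↔ ∑ s, c s • imageMonomial φ s = 0 := by
  rw [degreeOneMap_eq_zero_iff hφ, ← coe_map_ofCoords]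
  exact (ZeroMemClass.coe_eq_zero).symm

lemma degreeOneMap_single (φ : scrollRing K a →ₐ[K] scrollRing K b) (s : Σ i, Fin (a i + 1)) :
    degreeOneMap φ (Pi.single s 1) = coords K b (imageMonomial φ s) := by
  change coords K b (φ ⟨ofCoords K a (Pi.single s 1), ofCoords_mem _⟩ : scrollRing K b) = _
  rw [coe_map_ofCoords]
  simp [Pi.single_apply]

/-- The `2 × 2` minors of the matrix of images of the `x^(a_i - k) y^k s_i` vanish. -/
lemma imageMonomial_mul_comm (φ : scrollRing K a →ₐ[K] scrollRing K b) {i i' : Fin d} {k k' : ℕ}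
    (hk : k + 1 < a i + 1) (hk' : k' + 1 < a i' + 1) :
    imageMonomial φ ⟨i, k, by omega⟩ * imageMonomial φ ⟨i', k' + 1, hk'⟩ =
      imageMonomial φ ⟨i, k + 1, hk⟩ * imageMonomial φ ⟨i', k', by omega⟩ := by
  have hprod : ∀ x y z w : scrollRing K a, (x : B K d) * y = z * w →
      (φ x : B K e) * φ y = φ z * φ w := by
    intro x y z w h
    have h' : x * y = z * w := Subtype.ext h
    have := congrArg (fun r => (φ r : B K e)) h'
    simpa only [map_mul, Subalgebra.coe_mul] using this
  refine hprod _ _ _ _ ?_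
  change linearMonomial K a _ * linearMonomial K a _ = linearMonomial K a _ * linearMonomial K a _
  simp only [linearMonomial]
  obtain ⟨p, hp⟩ : ∃ p, a i = k + 1 + p := ⟨a i - (k + 1), by omega⟩
  obtain ⟨q, hq⟩ : ∃ q, a i' = k' + 1 + q := ⟨a i' - (k' + 1), by omega⟩
  rw [show a i - k = p + 1 by omega, show a i' - (k' + 1) = q by omega,
    show a i - (k + 1) = p by omega, show a i' - k' = q + 1 by omega]
  simp only [map_mul, map_pow]
  ring

lemma imageMonomial_isHomogeneous {φ : scrollRing K a →ₐ[K] scrollRing K b} (hφ : IsGraded φ)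
    (s : Σ i, Fin (a i + 1)) : (imageMonomial φ s).IsHomogeneous 1 :=
  hφ 1 _ (linearMonomial_isHomogeneous s)

/-- The kernel in degree one being a line, any two of its elements are proportional. -/
lemma exists_eq_smul_of_sum_eq_zero {φ : scrollRing K a →ₐ[K] scrollRing K b}
    (hφ : IsGraded φ)
    (hker : Module.finrank K (LinearMap.ker (degreeOneMap φ)) = 1)
    {c c' : (Σ i, Fin (a i + 1)) → K} (hc : ∑ s, c s • imageMonomial φ s = 0)
    (hc' : ∑ s, c' s • imageMonomial φ s = 0) (h0 : c ≠ 0) : ∃ t : K, c' = t • c := by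
  rw [← degreeOneMap_eq_zero_iff_sum hφ] at hc hc'
  obtain ⟨t, ht⟩ := (finrank_eq_one_iff_of_nonzero' (⟨c, hc⟩ : LinearMap.ker (degreeOneMap φ))
    (fun h => h0 (congrArg Subtype.val h))).mp hker ⟨c', hc'⟩
  exact ⟨t, (congrArg Subtype.val ht).symm⟩

/-- A one-dimensional kernel contains at most one of the basis elements. -/
lemma eq_of_imageMonomial_eq_zero {φ : scrollRing K a →ₐ[K] scrollRing K b} (hφ : IsGraded φ)
    (hker : Module.finrank K (LinearMap.ker (degreeOneMap φ)) = 1)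
    {s s' : Σ i, Fin (a i + 1)} (hs : imageMonomial φ s = 0) (hs' : imageMonomial φ s' = 0) :
    s = s' := by
  classical
  by_contra hne
  obtain ⟨t, ht⟩ := exists_eq_smul_of_sum_eq_zero hφ hker
    (c := Pi.single s 1) (c' := Pi.single s' 1) (by simp [Pi.single_apply, hs])
    (by simp [Pi.single_apply, hs']) (by simp)
  have := congrFun ht s'
  simp [Ne.symm hne] at this

/-- The vanishing of the `2 × 2` minors over the factorial domain `A[t]` gives a common ratio:
the image of `h(x, y) s_i` is `h(α, β) w_i`. -/
lemma exists_imageMonomial_eq {φ : scrollRing K a →ₐ[K] scrollRing K b} (hφ : IsGraded φ)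
    (hker : Module.finrank K (LinearMap.ker (degreeOneMap φ)) = 1) (ha_pos : ∀ i, 0 < a i)
    (i₀ : Fin d) :
    ∃ (α β : B K e) (w : Fin d → B K e), IsRelPrime α β ∧ (∀ i, w i ≠ 0) ∧
      ∀ i (k : Fin (a i + 1)), imageMonomial φ ⟨i, k⟩ = α ^ (a i - k) * β ^ (k : ℕ) * w i := by
  have h₀ : 0 + 1 < a i₀ + 1 := by have := ha_pos i₀; omega
  obtain ⟨α, β, g, hαβ, hg, hα, hβ⟩ : ∃ α β g, IsRelPrime α β ∧ g ≠ 0 ∧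
      g * α = imageMonomial φ ⟨i₀, 0, by omega⟩ ∧ g * β = imageMonomial φ ⟨i₀, 0 + 1, h₀⟩ := by
    by_cases h0 : imageMonomial φ ⟨i₀, 0, by omega⟩ = 0
    · have h1 : imageMonomial φ ⟨i₀, 0 + 1, h₀⟩ ≠ 0 := fun h1 => by
        have := eq_of_imageMonomial_eq_zero hφ hker h0 h1
        simp at this
      obtain ⟨α, β, g, h, hα, hβ⟩ := UniqueFactorizationMonoid.exists_reduced_factors'
        (imageMonomial φ ⟨i₀, 0, by omega⟩) _ h1
      exact ⟨α, β, g, h, by rintro rfl; exact h1 (by rw [← hβ, zero_mul]), hα, hβ⟩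
    · obtain ⟨α, β, g, h, hα, hβ⟩ := UniqueFactorizationMonoid.exists_reduced_factors
        _ h0 (imageMonomial φ ⟨i₀, 0 + 1, h₀⟩)
      exact ⟨α, β, g, h, by rintro rfl; exact h0 (by rw [← hα, zero_mul]), hα, hβ⟩
  have hw : ∀ i, ∃ w, ∀ (k : Fin (a i + 1)),
      imageMonomial φ ⟨i, k⟩ = α ^ (a i - k) * β ^ (k : ℕ) * w := by
    intro i
    obtain ⟨w, hw⟩ := exists_eq_pow_mul_pow_mul hαβ
      (fun k => if h : k < a i + 1 then imageMonomial φ ⟨i, k, h⟩ else 0) (a i) (by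
        intro k hk
        rw [dif_pos (by omega), dif_pos (by omega)]
        have := imageMonomial_mul_comm φ h₀ (i' := i) (k' := k) (by omega)
        rw [← hα, ← hβ, mul_assoc, mul_assoc] at this
        exact mul_left_cancel₀ hg this)
    refine ⟨w, fun k => ?_⟩
    have := hw k (by omega)
    rwa [dif_pos k.2] at this
  choose w hw using hw
  refine ⟨α, β, w, hαβ, fun i h0 => ?_, hw⟩
  have h1 : 0 + 1 < a i + 1 := by have := ha_pos i; omega
  have := eq_of_imageMonomial_eq_zero hφ hker (s := ⟨i, 0, by omega⟩) (s' := ⟨i, 0 + 1, h1⟩)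
    (by rw [hw, h0, mul_zero]) (by rw [hw, h0, mul_zero])
  simp at this

end ImageMonomial

/-! ### Hyperplane sections satisfy the numerical conditions -/

lemma totalDegree_pow_of_noZeroDivisors {σ R : Type*} [CommRing R] [IsDomain R]
    {f : MvPolynomial σ R} (hf : f ≠ 0) (k : ℕ) : (f ^ k).totalDegree = k * f.totalDegree := by
  induction k with
  | zero => simp
  | succ k ih =>
    rw [pow_succ, totalDegree_mul_of_isDomain (pow_ne_zero k hf) hf, ih]
    ring

/-- A nonzero linear form `α ^ N * w` in which `α` has positive degree has `N = 1` and `w`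
constant. -/
lemma eq_one_of_isHomogeneous_pow_mul {σ R : Type*} [CommRing R] [IsDomain R]
    {α w : MvPolynomial σ R} {N : ℕ} (hN : 0 < N) (hα : 0 < α.totalDegree) (hw : w ≠ 0)
    (h : (α ^ N * w).IsHomogeneous 1) : N = 1 ∧ ∃ ω, w = C ω := by
  have hα0 : α ≠ 0 := by rintro rfl; simp at hα
  have h1 := h.totalDegree (mul_ne_zero (pow_ne_zero N hα0) hw)
  rw [totalDegree_mul_of_isDomain (pow_ne_zero N hα0) hw,
    totalDegree_pow_of_noZeroDivisors hα0] at h1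
  have h2 : N * 1 ≤ N * α.totalDegree := Nat.mul_le_mul_left N hα
  exact ⟨by omega, _, totalDegree_eq_zero_iff_eq_C.mp (by omega)⟩

lemma C_eq_zero_of_dvd {σ R : Type*} [CommRing R] [IsDomain R]
    {α : MvPolynomial σ R} (hα : 0 < α.totalDegree) {ω : R} (h : α ∣ C ω) :
    ω = 0 := by
  by_contra hω
  obtain ⟨q, hq⟩ := h
  have hC : (C ω : MvPolynomial σ R) ≠ 0 := by simpa using hω
  have h0 : α * q ≠ 0 := hq ▸ hC
  have := congrArg MvPolynomial.totalDegree hq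
  rw [totalDegree_C, totalDegree_mul_of_isDomain (left_ne_zero_of_mul h0)
    (right_ne_zero_of_mul h0)] at this
  omega

/-- If `α C ω + β C ω' = 0` with `α, β` coprime and `α` not constant, then `ω = ω' = 0`. -/
lemma eq_zero_of_mul_add_mul_eq_zero {σ R : Type*} [CommRing R] [IsDomain R]
    [UniqueFactorizationMonoid R] {α β : MvPolynomial σ R} (hαβ : IsRelPrime α β)
    (hdeg : 0 < α.totalDegree) {ω ω' : R} (h : α * C ω + β * C ω' = 0) : ω = 0 ∧ ω' = 0 := by
  have h' : α ∣ β * C ω' := ⟨-C ω, by linear_combination h⟩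
  have h0 : ω' = 0 := C_eq_zero_of_dvd hdeg (hαβ.dvd_of_dvd_mul_left h')
  rw [h0, map_zero, mul_zero, add_zero] at h
  have hα0 : α ≠ 0 := by rintro rfl; simp at hdeg
  exact ⟨C_eq_zero.mp ((mul_eq_zero.mp h).resolve_left hα0), h0⟩

section CommonRatio
variable {K : Type*} [Field K] {d e : ℕ} {a : Fin d → ℕ} {b : Fin e → ℕ}

/-- The common ratio does not involve the variables `t_j`. Otherwise all `a_i` equal one and the
map in degree one is `Σ (p_i x + q_i y) s_i ↦ α Σ p_i ω_i + β Σ q_i ω_i`, whose kernel is a direct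
sum of two copies of the same space and so has even dimension. -/
lemma totalDegree_eq_zero_of_imageMonomial_eq {φ : scrollRing K a →ₐ[K] scrollRing K b}
    (hφ : IsGraded φ)
    (hker : Module.finrank K (LinearMap.ker (degreeOneMap φ)) = 1) (ha_pos : ∀ i, 0 < a i)
    {α β : B K e} {w : Fin d → B K e} (hαβ : IsRelPrime α β) (hw : ∀ i, w i ≠ 0)
    (h : ∀ i (k : Fin (a i + 1)), imageMonomial φ ⟨i, k⟩ = α ^ (a i - k) * β ^ (k : ℕ) * w i) :
    α.totalDegree = 0 ∧ β.totalDegree = 0 := by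
  rw [← Nat.add_eq_zero_iff]
  by_contra hdeg
  have hdeg' : 0 < α.totalDegree ∨ 0 < β.totalDegree := by omega
  have h1 : ∀ i, a i = 1 ∧ ∃ ω, w i = C ω := by
    intro i
    rcases hdeg' with hα | hβ
    · have := imageMonomial_isHomogeneous hφ ⟨i, 0⟩
      rw [h] at this
      simp only [Fin.val_zero, Nat.sub_zero, pow_zero, mul_one] at this
      exact eq_one_of_isHomogeneous_pow_mul (ha_pos i) hα (hw i) this
    · have := imageMonomial_isHomogeneous hφ ⟨i, Fin.last (a i)⟩
      rw [h] at this
      simp only [Fin.val_last, Nat.sub_self, pow_zero, one_mul] at this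
      exact eq_one_of_isHomogeneous_pow_mul (ha_pos i) hβ (hw i) this
  choose h1 ω hω using h1
  obtain rfl : a = fun _ => 1 := funext h1
  have hsum : ∀ c : (Σ _ : Fin d, Fin (1 + 1)) → K, ∑ s, c s • imageMonomial φ s =
      α * C (∑ i, C (c ⟨i, 0⟩) * ω i) + β * C (∑ i, C (c ⟨i, 1⟩) * ω i) := by
    intro c
    rw [Fintype.sum_sigma]
    simp only [h, hω, map_sum, map_mul, Finset.mul_sum,
      ← Finset.sum_add_distrib, Algebra.smul_def]
    refine Finset.sum_congr rfl fun i _ => ?_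
    have hC : ∀ t : K, algebraMap K (B K e) t = C (C t) := fun _ => rfl
    simp [hC]
    ring
  obtain ⟨⟨c, hc⟩, hc0, -⟩ := finrank_eq_one_iff'.mp hker
  have hc0' : c ≠ 0 := fun h0 => hc0 (Subtype.ext h0)
  rw [LinearMap.mem_ker, degreeOneMap_eq_zero_iff_sum hφ, hsum] at hc
  have hz : ∑ i, C (c ⟨i, 0⟩) * ω i = 0 ∧ ∑ i, C (c ⟨i, 1⟩) * ω i = 0 := by
    rcases hdeg' with hα | hβ
    · exact eq_zero_of_mul_add_mul_eq_zero hαβ hα hc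
    · rw [add_comm] at hc
      exact (eq_zero_of_mul_add_mul_eq_zero hαβ.symm hβ hc).symm
  -- A vanishing combination `p` of the `ω_i` yields the two kernel elements `Σ p_i x s_i` and
  -- `Σ p_i y s_i`.
  have hp : ∀ p : Fin d → K, ∑ i, C (p i) * ω i = 0 → p = 0 := by
    intro p hp
    by_contra hp0
    obtain ⟨i, hi⟩ := Function.ne_iff.mp hp0
    obtain ⟨t, ht⟩ := exists_eq_smul_of_sum_eq_zero hφ hker
      (c := fun s => if s.2 = 0 then p s.1 else 0) (c' := fun s => if s.2 = 1 then p s.1 else 0)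
      (by rw [hsum]; simp [hp]) (by rw [hsum]; simp [hp])
      (fun h0 => hi (by simpa using congrFun h0 ⟨i, 0⟩))
    have := congrFun ht ⟨i, 1⟩
    simp at this
    exact hi this
  have hA := hp _ hz.1
  have hB := hp _ hz.2
  apply hc0'
  ext ⟨i, k⟩
  fin_cases k
  · exact congrFun hA i
  · exact congrFun hB i

/-- With at least two summands, a map with one-dimensional kernel in degree one sends
`A_{a_i} s_i` to a form involving `t_j` only if `a_i ≤ b_j`. -/
lemma le_of_coeff_imageMonomial_ne_zero {φ : scrollRing K a →ₐ[K] scrollRing K b} (hφ : IsGraded φ)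
    (hker : Module.finrank K (LinearMap.ker (degreeOneMap φ)) = 1) (ha_pos : ∀ i, 0 < a i)
    {i₀ i₁ : Fin d} (hne : i₀ ≠ i₁) {i : Fin d} {k : Fin (a i + 1)} {j : Fin e}
    (hcoeff : coeff (Finsupp.single j 1) (imageMonomial φ ⟨i, k⟩) ≠ 0) : a i ≤ b j := by
  classical
  obtain ⟨α, β, w, hαβ, hw, h⟩ := exists_imageMonomial_eq hφ hker ha_pos i₀
  obtain ⟨hα, hβ⟩ := totalDegree_eq_zero_of_imageMonomial_eq hφ hker ha_pos hαβ hw h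
  obtain ⟨α, rfl⟩ : ∃ α₀, α = C α₀ := ⟨_, totalDegree_eq_zero_iff_eq_C.mp hα⟩
  obtain ⟨β, rfl⟩ : ∃ β₀, β = C β₀ := ⟨_, totalDegree_eq_zero_iff_eq_C.mp hβ⟩
  have hcf : ∀ k : Fin (a i + 1), coeff (Finsupp.single j 1) (imageMonomial φ ⟨i, k⟩) =
      α ^ (a i - k) * β ^ (k : ℕ) * coeff (Finsupp.single j 1) (w i) := by
    intro k
    rw [h, ← map_pow, ← map_pow, ← map_mul, coeff_C_mul]
  have hw0 : coeff (Finsupp.single j 1) (w i) ≠ 0 := by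
    rw [hcf] at hcoeff
    exact right_ne_zero_of_mul hcoeff
  have hhom : ∀ k : Fin (a i + 1),
      (coeff (Finsupp.single j 1) (imageMonomial φ ⟨i, k⟩)).IsHomogeneous (b j) := by
    intro k
    have := mem_scrollRing_iff.mp
      (φ ⟨linearMonomial K a ⟨i, k⟩, linearMonomial_mem _⟩).2 (Finsupp.single j 1)
    have hwt : ∑ l, (Finsupp.single j 1 : Fin e →₀ ℕ) l * b l = b j := by
      simp [Finsupp.single_apply]
    rwa [hwt] at this
  have hbound : ∀ γ : A K, 0 < γ.totalDegree →
      (γ ^ a i * coeff (Finsupp.single j 1) (w i)).IsHomogeneous (b j) → a i ≤ b j := by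
    intro γ hγ hγw
    have hγ0 : γ ≠ 0 := by rintro rfl; simp at hγ
    have h1 := hγw.totalDegree (mul_ne_zero (pow_ne_zero _ hγ0) hw0)
    rw [totalDegree_mul_of_isDomain (pow_ne_zero _ hγ0) hw0,
      totalDegree_pow_of_noZeroDivisors hγ0] at h1
    have h2 : a i * 1 ≤ a i * γ.totalDegree := Nat.mul_le_mul_left _ hγ
    omega
  rcases Nat.eq_zero_or_pos α.totalDegree with hα' | hα'
  swap
  · refine hbound α hα' ?_
    have := hhom 0
    rw [hcf] at this
    simpa using this
  rcases Nat.eq_zero_or_pos β.totalDegree with hβ' | hβ'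
  swap
  · refine hbound β hβ' ?_
    have := hhom (Fin.last _)
    rw [hcf] at this
    simpa using this
  -- Now `α = p` and `β = q` are scalars, and each `(q x - p y) x^(a_i - 1) s_i` is in the kernel.
  obtain ⟨p, rfl⟩ : ∃ p, α = C p := ⟨_, totalDegree_eq_zero_iff_eq_C.mp hα'⟩
  obtain ⟨q, rfl⟩ : ∃ q, β = C q := ⟨_, totalDegree_eq_zero_iff_eq_C.mp hβ'⟩
  exfalso
  have hpq : ¬ (q = 0 ∧ p = 0) := by
    rintro ⟨rfl, rfl⟩
    rw [map_zero, map_zero] at hαβ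
    exact not_isUnit_zero (isRelPrime_zero_left.mp hαβ)
  have hlt : ∀ i, 0 + 1 < a i + 1 := fun i => by have := ha_pos i; omega
  let c : Fin d → (Σ i, Fin (a i + 1)) → K := fun i =>
    q • Pi.single ⟨i, ⟨0, by omega⟩⟩ 1 - p • Pi.single ⟨i, ⟨0 + 1, hlt i⟩⟩ 1
  have hc0 : ∀ i i' : Fin d, c i ⟨i', ⟨0, by omega⟩⟩ = if i' = i then q else 0 := by
    intro i i'
    by_cases hi : i' = i
    · subst hi
      simp [c]
    · simp [c, hi]
  have hc1 : ∀ i i' : Fin d, c i ⟨i', ⟨0 + 1, hlt i'⟩⟩ = if i' = i then -p else 0 := by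
    intro i i'
    by_cases hi : i' = i
    · subst hi
      simp [c]
    · simp [c, hi]
  have hcker : ∀ i, ∑ s, c i s • imageMonomial φ s = 0 := by
    intro i
    have h1 : ∑ s, c i s • imageMonomial φ s = q • imageMonomial φ ⟨i, ⟨0, by omega⟩⟩ -
        p • imageMonomial φ ⟨i, ⟨0 + 1, hlt i⟩⟩ := by
      simp [c, sub_smul, Finset.sum_sub_distrib, Pi.single_apply]
    have hC : ∀ t : K, algebraMap K (B K e) t = C (C t) := fun _ => rfl
    obtain ⟨N, hN⟩ : ∃ N, a i = N + 1 := ⟨a i - 1, by have := ha_pos i; omega⟩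
    rw [h1, h, h, Algebra.smul_def, Algebra.smul_def, hC, hC]
    simp only
    rw [show a i - 0 = N + 1 by omega, show a i - (0 + 1) = N by omega]
    ring
  have hcne : ∀ i, c i ≠ 0 := by
    intro i h0
    refine hpq ⟨?_, ?_⟩
    · have := hc0 i i
      rw [h0, if_pos rfl] at this
      exact this.symm
    · have := hc1 i i
      rw [h0, if_pos rfl] at this
      exact neg_eq_zero.mp this.symm
  obtain ⟨t, ht⟩ := exists_eq_smul_of_sum_eq_zero hφ hker (hcker i₀) (hcker i₁) (hcne i₀)
  refine hpq ⟨?_, ?_⟩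
  · have := congrFun ht ⟨i₁, ⟨0, by omega⟩⟩
    rw [Pi.smul_apply, hc0, hc0, if_pos rfl, if_neg hne.symm, smul_zero] at this
    exact this
  · have := congrFun ht ⟨i₁, ⟨0 + 1, hlt i₁⟩⟩
    rw [Pi.smul_apply, hc1, hc1, if_pos rfl, if_neg hne.symm, smul_zero] at this
    exact neg_eq_zero.mp this

end CommonRatio

lemma numericalConditions_of_isHyperplaneSection {K : Type*} [Field K] {n : ℕ}
    {a : Fin (n + 1) → ℕ} {b : Fin n → ℕ} (ha_pos : ∀ i, 0 < a i) (ha : Monotone a)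
    (hb : Monotone b) (h : IsHyperplaneSection K a b) : NumericalConditions a b := by
  classical
  obtain ⟨L, hL0, hL, φ, hφ, hsurj, hkerφ⟩ := h
  have hker := ker_degreeOneMap hφ hL0 hL hkerφ
  have hS := degreeOneMap_surjective hφ hsurj
  have hdim := LinearMap.finrank_range_add_finrank_ker (degreeOneMap φ)
  rw [LinearMap.range_eq_top.mpr hS, finrank_top, hker, Module.finrank_fintype_fun_eq_card,
    Module.finrank_fintype_fun_eq_card, Fintype.card_sigma, Fintype.card_sigma] at hdim
  simp only [Fintype.card_fin, Finset.sum_add_distrib, Finset.sum_const, Finset.card_univ,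
    smul_eq_mul, mul_one] at hdim
  have hsum : ∑ i, a i = ∑ j, b j := by omega
  have hn : n ≠ 0 := by
    rintro rfl
    have := ha_pos 0
    simp at hsum
    omega
  have hne : (0 : Fin (n + 1)) ≠ Fin.last n := by
    intro h
    exact hn (congrArg Fin.val h).symm
  refine numericalConditions_of_rank_le ha_pos ha hb hsum fun I J hIJ => ?_
  rw [← card_sigma_filter, ← card_sigma_filter]
  refine card_le_of_surjective_of_support _ hS _ _ ?_
  rintro ⟨i, k⟩ hi ⟨j, l⟩ hj
  simp only [Finset.mem_sigma, Finset.mem_univ, and_true] at hi hj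
  rw [degreeOneMap_single]
  by_contra h0
  refine (hIJ i hi j hj).not_ge (le_of_coeff_imageMonomial_ne_zero hφ hker ha_pos hne (k := k) ?_)
  intro h1
  apply h0
  change coeff _ (coeff (Finsupp.single j 1) (imageMonomial φ ⟨i, k⟩)) = 0
  rw [h1, coeff_zero]

/-! ### Ideals of height two in `K[x, y]` -/

section Height
variable {K : Type*} [Field K]

lemma X_one_not_dvd_X_zero_pow (N : ℕ) : ¬ (X 1 : A K) ∣ X 0 ^ N := by
  intro h
  have := (X_prime : Prime (X 1 : A K)).dvd_of_dvd_pow h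
  rw [X_dvd_X] at this
  exact one_ne_zero this

lemma height_eq_two {I : Ideal (A K)} (hI : I ≠ ⊤) {p q : ℕ} (h0 : X 0 ^ p ∈ I)
    (h1 : X 1 ^ q ∈ I) : I.height = 2 := by
  apply le_antisymm
  · have := Ideal.height_le_ringKrullDim_of_ne_top hI
    rw [MvPolynomial.ringKrullDim_of_isNoetherianRing, ringKrullDim_eq_zero_of_field] at this
    simp only [Nat.card_eq_fintype_card, Fintype.card_fin, zero_add] at this
    exact (WithBot.coe_le_coe (b := (2 : ℕ∞))).mp this
  · rw [Ideal.height_eq_inf_minimalPrimes]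
    refine le_iInf₂ fun J hJ => ?_
    have : J.IsPrime := hJ.1.1
    have hX0 : (X 0 : A K) ∈ J := this.mem_of_pow_mem _ (hJ.1.2 h0)
    have hX1 : (X 1 : A K) ∈ J := this.mem_of_pow_mem _ (hJ.1.2 h1)
    have hp : (Ideal.span {(X 0 : A K)}).IsPrime :=
      (Ideal.span_singleton_prime (X_ne_zero 0)).mpr X_prime
    have hlt : (⊥ : Ideal (A K)) < Ideal.span {(X 0 : A K)} := by
      rw [bot_lt_iff_ne_bot, Ne, Ideal.span_singleton_eq_bot]
      exact X_ne_zero 0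
    have hlt' : Ideal.span {(X 0 : A K)} < J := by
      refine lt_of_le_of_ne ((Ideal.span_singleton_le_iff_mem _).mpr hX0) ?_
      rintro rfl
      rw [Ideal.mem_span_singleton, X_dvd_X] at hX1
      exact zero_ne_one hX1
    calc (2 : ℕ∞) = (⊥ : Ideal (A K)).height + 1 + 1 := by rw [Ideal.height_bot]; norm_num
      _ ≤ (Ideal.span {(X 0 : A K)}).height + 1 := by
        gcongr
        exact Ideal.height_add_one_le_of_lt_of_isPrime hlt
      _ ≤ J.height := Ideal.height_add_one_le_of_lt_of_isPrime hlt'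

/-- A common prime factor would put the ideal inside a principal prime ideal, of height at most one
by Krull's theorem. -/
lemma exists_not_dvd_of_height_eq_two {ι : Type*} {f : ι → A K}
    (hf : (Ideal.span (Set.range f)).height = 2) {p : A K} (hp : Prime p) : ∃ i, ¬ p ∣ f i := by
  by_contra! h
  have hle : Ideal.span (Set.range f) ≤ Ideal.span {p} := by
    rw [Ideal.span_le]
    rintro _ ⟨i, rfl⟩
    exact Ideal.mem_span_singleton.mpr (h i)
  have : (Ideal.span {p}).IsPrime := (Ideal.span_singleton_prime hp.ne_zero).mpr hp
  have h1 : (Ideal.span {p}).height ≤ 1 :=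
    Ideal.height_le_one_of_isPrincipal_of_mem_minimalPrimes (Ideal.span {p}) _
      ⟨⟨this, le_rfl⟩, fun _ hq _ => hq.2⟩
  have := (hf ▸ Ideal.height_mono hle).trans h1
  norm_num at this

end Height

/-! ### A bidiagonal matrix of monomials realizes the numerical conditions -/

section HomogeneousVec
variable {K : Type*} [Field K] {d : ℕ} {a : Fin d → ℕ}

lemma IsHomogeneousVec.sub {g h : Fin d → A K} {c : ℕ} (hg : IsHomogeneousVec a g c)
    (hh : IsHomogeneousVec a h c) : IsHomogeneousVec a (g - h) c := fun i =>
  ⟨fun hi => ((hg i).1 hi).sub ((hh i).1 hi), fun hi => by simp [(hg i).2 hi, (hh i).2 hi]⟩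

lemma isHomogeneousVec_zero (c : ℕ) : IsHomogeneousVec a (0 : Fin d → A K) c := fun _ =>
  ⟨fun _ => isHomogeneous_zero _ _ _, fun _ => rfl⟩

lemma isHomogeneousVec_single {i : Fin d} {c : ℕ} {f : A K} (hi : a i ≤ c)
    (hf : f.IsHomogeneous (c - a i)) : IsHomogeneousVec a (Pi.single i f) c := by
  intro k
  by_cases hk : k = i
  · subst hk
    exact ⟨fun _ => by simpa using hf, fun h => by omega⟩
  · simpa [hk] using fun _ => isHomogeneous_zero _ _ _

end HomogeneousVec

lemma syzygyMap_apply {K : Type*} [Field K] {d : ℕ} (f h : Fin d → A K) :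
    syzygyMap f h = ∑ i, h i * f i := by
  simp [syzygyMap, Fintype.linearCombination_apply]

lemma occursAsSyzygyDegrees_of_numericalConditions {K : Type*} [Field K] {n : ℕ}
    {a : Fin (n + 1) → ℕ} {b : Fin n → ℕ} (ha_pos : ∀ i, 0 < a i)
    (h : NumericalConditions a b) : OccursAsSyzygyDegrees K a b := by
  classical
  obtain ⟨hsum, hab, v, hv, hq⟩ := h
  have hp0 : ∀ j < v, b j = a j.castSucc := fun j hj =>
    le_antisymm (not_lt.mp fun hlt => (hv.2 hlt).not_gt hj) (hab j)
  -- The exponents of `x` and `y` in `f_i`.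
  let P : Fin (n + 1) → ℕ := fun i =>
    ∑ j with Fin.castSucc j < i, (b j - a (Fin.castSucc j))
  let Q : Fin (n + 1) → ℕ := fun i =>
    ∑ j with i ≤ Fin.castSucc j, (b j - a (Fin.succ j))
  have hPsucc : ∀ j : Fin n, P j.succ = P j.castSucc + (b j - a j.castSucc) := by
    intro j
    have : (Finset.univ.filter fun k : Fin n => k.castSucc < j.succ) =
        insert j (Finset.univ.filter fun k : Fin n => k.castSucc < j.castSucc) := by
      ext k
      simp only [Finset.mem_filter, Finset.mem_univ, true_and, Finset.mem_insert, Fin.lt_def,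
        Fin.ext_iff, Fin.val_castSucc, Fin.val_succ]
      omega
    simp only [P]
    rw [this, Finset.sum_insert (by simp), add_comm]
  have hQcast : ∀ j : Fin n, Q j.castSucc = Q j.succ + (b j - a j.succ) := by
    intro j
    have : (Finset.univ.filter fun k : Fin n => j.castSucc ≤ k.castSucc) =
        insert j (Finset.univ.filter fun k : Fin n => j.succ ≤ k.castSucc) := by
      ext k
      simp only [Finset.mem_filter, Finset.mem_univ, true_and, Finset.mem_insert, Fin.le_def,
        Fin.ext_iff, Fin.val_castSucc, Fin.val_succ]
      omega
    simp only [Q]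
    rw [this, Finset.sum_insert (by simp [← Fin.castSucc_lt_iff_succ_le]), add_comm]
  have hQanti : ∀ i k, i ≤ k → Q k ≤ Q i := fun i k hik =>
    Finset.sum_le_sum_of_subset fun j => by
      simp only [Finset.mem_filter, Finset.mem_univ, true_and]
      exact hik.trans
  have hPv : P v.castSucc = 0 := by
    refine Finset.sum_eq_zero fun j hj => ?_
    have hjv : j < v := by simpa using hj
    rw [hp0 j hjv, Nat.sub_self]
  have hQlast : Q (Fin.last n) = 0 := by
    refine Finset.sum_eq_zero fun j hj => ?_
    simp only [Finset.mem_filter, Finset.mem_univ, true_and] at hj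
    exact absurd hj (not_le.mpr (Fin.castSucc_lt_last j))
  have hPlast : P (Fin.last n) = a (Fin.last n) := by
    have h1 : P (Fin.last n) = ∑ j, (b j - a j.castSucc) := by
      simp only [P]
      congr 1
      ext j
      simp [Fin.castSucc_lt_last]
    have h2 : ∑ j, (b j - a j.castSucc) + ∑ j : Fin n, a j.castSucc = ∑ j, b j := by
      rw [← Finset.sum_add_distrib]
      exact Finset.sum_congr rfl fun j _ => Nat.sub_add_cancel (hab j)
    rw [Fin.sum_univ_castSucc] at hsum
    omega
  have hPQ : ∀ i, v.castSucc ≤ i → P i + Q i = a i := by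
    intro i
    induction i using Fin.reverseInduction with
    | last => intro; rw [hPlast, hQlast, add_zero]
    | cast j ih =>
      intro hj
      have hvj : v ≤ j := hj
      have h1 := ih (hj.trans (Fin.castSucc_le_succ j))
      have h2 := hPsucc j
      have h3 := hQcast j
      have h4 := hq j hvj
      have h5 := hab j
      omega
  let f : Fin (n + 1) → A K := fun i => if i < v.castSucc then 0 else X 0 ^ P i * X 1 ^ Q i
  let y : Fin n → A K := fun j => if v ≤ j then X 1 ^ (b j - a j.succ) else 0
  let g : Fin n → Fin (n + 1) → A K := fun j =>
    Pi.single j.castSucc (X 0 ^ (b j - a j.castSucc)) - Pi.single j.succ (y j)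
  have hf_lt : ∀ i, i < v.castSucc → f i = 0 := fun i hi => if_pos hi
  have hf_ge : ∀ i, v.castSucc ≤ i → f i = X 0 ^ P i * X 1 ^ Q i := fun i hi =>
    if_neg (not_lt.mpr hi)
  have hrec : ∀ j, X 0 ^ (b j - a j.castSucc) * f j.castSucc = y j * f j.succ := by
    intro j
    by_cases hj : v ≤ j
    · have hj' : v.castSucc ≤ j.castSucc := hj
      rw [hf_ge _ hj', hf_ge _ (hj'.trans (Fin.castSucc_le_succ j)), hPsucc, hQcast]
      simp only [y, if_pos hj]
      ring
    · rw [hf_lt _ (not_le.mp hj), mul_zero]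
      simp only [y, if_neg hj, zero_mul]
  have hdot : ∀ j, ∑ i, g j i * f i = 0 := by
    intro j
    have : ∑ i, g j i * f i = X 0 ^ (b j - a j.castSucc) * f j.castSucc - y j * f j.succ := by
      simp [g, sub_mul, Finset.sum_sub_distrib, Pi.single_apply]
    rw [this, hrec, sub_self]
  have hdot' : ∀ (h : Fin (n + 1) → A K) (c : A K) (j : Fin n),
      ∑ i, (h + c • g j) i * f i = ∑ i, h i * f i := by
    intro h c j
    simp only [Pi.add_apply, Pi.smul_apply, smul_eq_mul, add_mul, mul_assoc,
      Finset.sum_add_distrib, ← Finset.mul_sum, hdot, mul_zero, add_zero]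
  refine ⟨f, ?_, ?_, g, ?_, ?_, ?_⟩
  · intro i
    rcases lt_or_ge i v.castSucc with hi | hi
    · rw [hf_lt i hi]
      exact isHomogeneous_zero _ _ _
    · rw [hf_ge i hi, ← hPQ i hi]
      exact isHomogeneous_X_pow_mul_X_pow _ _
  · refine height_eq_two (p := a (Fin.last n)) (q := a v.castSucc) ?_ ?_ ?_
    · have hle : Ideal.span (Set.range f) ≤ RingHom.ker (constantCoeff (R := K) (σ := Fin 2)) := by
        rw [Ideal.span_le]
        rintro _ ⟨i, rfl⟩
        rcases lt_or_ge i v.castSucc with hi | hi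
        · simp [hf_lt i hi]
        · have h1 := hPQ i hi
          have h2 := ha_pos i
          simp only [SetLike.mem_coe, RingHom.mem_ker, hf_ge i hi, map_mul, map_pow,
            constantCoeff_X, ← pow_add]
          exact zero_pow (by omega)
      intro htop
      rw [htop] at hle
      have : constantCoeff (1 : A K) = 0 := hle (Submodule.mem_top (x := (1 : A K)))
      simp at this
    · have : f (Fin.last n) = X 0 ^ a (Fin.last n) := by
        rw [hf_ge _ (Fin.le_last _), hPlast, hQlast, pow_zero, mul_one]
      rw [← this]
      exact Ideal.subset_span ⟨_, rfl⟩
    · have : f v.castSucc = X 1 ^ a v.castSucc := by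
        rw [hf_ge _ le_rfl, ← hPQ _ le_rfl, hPv, pow_zero, one_mul, zero_add]
      rw [← this]
      exact Ideal.subset_span ⟨_, rfl⟩
  · intro j
    refine IsHomogeneousVec.sub
      (isHomogeneousVec_single (hab j) (isHomogeneous_X_pow _ _)) ?_
    by_cases hj : v ≤ j
    · simp only [y, if_pos hj]
      exact isHomogeneousVec_single (hq j hj) (isHomogeneous_X_pow _ _)
    · simp only [y, if_neg hj, Pi.single_zero]
      exact isHomogeneousVec_zero _
  · rw [Fintype.linearIndependent_iff]
    intro c hc j
    induction j using WellFoundedLT.induction with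
    | ind j ih =>
    have h1 := congrFun hc j.castSucc
    rw [Finset.sum_apply, Finset.sum_eq_single j] at h1
    · simpa [g, Pi.single_apply, Fin.castSucc_lt_succ.ne, X_ne_zero] using h1
    · intro k _ hkj
      rcases lt_or_gt_of_ne hkj with hk | hk
      · rw [ih k hk, zero_smul, Pi.zero_apply]
      · have h2 : j.castSucc ≠ k.castSucc := fun h => hkj (Fin.castSucc_injective n h).symm
        have h3 : j.castSucc ≠ k.succ := by
          intro h
          simp only [Fin.ext_iff, Fin.lt_def, Fin.val_castSucc, Fin.val_succ] at h hk
          omega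
        simp [g, h2, h3]
    · simp
  · apply le_antisymm
    · rw [Submodule.span_le]
      rintro _ ⟨j, rfl⟩
      rw [SetLike.mem_coe, LinearMap.mem_ker, syzygyMap_apply, hdot]
    · -- Eliminate the coordinates of a syzygy from the last one down to the one at `v`.
      have key : ∀ i, v.castSucc ≤ i → ∀ h : Fin (n + 1) → A K, ∑ k, h k * f k = 0 →
          (∀ k, i < k → h k = 0) → h ∈ Submodule.span (A K) (Set.range g) := by
        have base : ∀ h : Fin (n + 1) → A K, ∑ k, h k * f k = 0 →
            (∀ k, v.castSucc < k → h k = 0) → h ∈ Submodule.span (A K) (Set.range g) := by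
          intro h hh hz
          rw [Finset.sum_eq_single v.castSucc] at hh
          · rw [hf_ge _ le_rfl] at hh
            have hv0 : h v.castSucc = 0 := by
              refine (mul_eq_zero.mp hh).resolve_right ?_
              exact mul_ne_zero (pow_ne_zero _ (X_ne_zero _)) (pow_ne_zero _ (X_ne_zero _))
            rw [pi_eq_sum_univ' h]
            refine Submodule.sum_mem _ fun k _ => ?_
            rcases lt_trichotomy k v.castSucc with hk | rfl | hk
            · obtain ⟨j, rfl⟩ : ∃ j : Fin n, k = j.castSucc :=
                ⟨k.castPred (Fin.ne_last_of_lt hk), by simp⟩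
              have hjv : j < v := hk
              have hgj : g j = Pi.single j.castSucc 1 := by
                simp [g, y, hp0 j hjv, not_le.mpr hjv]
              refine Submodule.smul_mem _ _ (Submodule.subset_span ⟨j, ?_⟩)
              rw [hgj]
            · rw [hv0, zero_smul]
              exact Submodule.zero_mem _
            · rw [hz k hk, zero_smul]
              exact Submodule.zero_mem _
          · intro k _ hk
            rcases lt_or_gt_of_ne hk with hk | hk
            · rw [hf_lt k hk, mul_zero]
            · rw [hz k hk, zero_mul]
          · simp
        intro i
        induction i using Fin.induction with
        | zero =>
          intro hi h hh hz
          exact base h hh fun k hk => hz k (lt_of_le_of_lt (Fin.zero_le _) hk)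
        | succ j ih =>
          intro hi h hh hz
          rcases hi.eq_or_lt with hi' | hi'
          · exact base h hh fun k hk => hz k (hi' ▸ hk)
          have hvj : v.castSucc ≤ j.castSucc := Fin.le_castSucc_iff.mpr hi'
          have hvj' : v ≤ j := hvj
          have hdvd : X 1 ^ Q j.castSucc ∣ h j.succ * f j.succ := by
            rw [← Finset.add_sum_erase _ _ (Finset.mem_univ j.succ)] at hh
            rw [eq_neg_of_add_eq_zero_left hh, dvd_neg]
            refine Finset.dvd_sum fun k hk => ?_
            have hk' := Finset.ne_of_mem_erase hk
            rcases lt_or_gt_of_ne hk' with hk' | hk'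
            · rcases lt_or_ge k v.castSucc with hkv | hkv
              · rw [hf_lt k hkv, mul_zero]
                exact dvd_zero _
              · rw [hf_ge k hkv]
                exact Dvd.dvd.mul_left (Dvd.dvd.mul_left
                  (pow_dvd_pow _ (hQanti _ _ (Fin.le_castSucc_iff.mpr hk'))) _) _
            · rw [hz k hk', zero_mul]
              exact dvd_zero _
          rw [hf_ge _ hi, hQcast, pow_add, mul_comm (X 1 ^ Q j.succ), ← mul_assoc] at hdvd
          have hdvd' := (mul_dvd_mul_iff_right (pow_ne_zero _ (X_ne_zero _))).mp hdvd
          have hrel : IsRelPrime (X 1 ^ (b j - a j.succ) : A K) (X 0 ^ P j.succ) :=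
            (((X_prime : Prime (X 1 : A K)).irreducible.isRelPrime_iff_not_dvd).mpr
              (X_one_not_dvd_X_zero_pow _)).pow_left
          obtain ⟨c, hc⟩ := hrel.dvd_of_dvd_mul_right hdvd'
          have hmem := ih hvj (h + c • g j) (by rw [hdot', hh]) (by
            intro k hk
            rcases (Fin.castSucc_lt_iff_succ_le.mp hk).eq_or_lt with rfl | hk'
            · simp [g, y, hvj', hc, (Fin.castSucc_lt_succ (i := j)).ne', mul_comm]
            · have h1 : k ≠ j.castSucc := hk.ne'
              have h2 : k ≠ j.succ := hk'.ne'
              simp [g, hz k hk', h1, h2])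
          have : h = (h + c • g j) - c • g j := by simp
          rw [this]
          exact Submodule.sub_mem _ hmem (Submodule.smul_mem _ _ (Submodule.subset_span ⟨j, rfl⟩))
      intro h hh
      rw [LinearMap.mem_ker, syzygyMap_apply] at hh
      exact key (Fin.last n) (Fin.le_last _) h hh fun k hk => absurd hk (not_lt.mpr (Fin.le_last k))

/-! ### The Hilbert–Burch theorem for a module of syzygies -/

section HilbertBurch

/-- If the `y_i` have no common prime factor and `x` divides every `y_i z`, then `x` divides `z`:
the prime factors of `x` can be cancelled one at a time. -/
lemma dvd_of_forall_dvd_mul {R ι : Type*} [CommRing R] [IsDomain R] [UniqueFactorizationMonoid R]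
    {y : ι → R} (hy : ∀ p, Prime p → ∃ i, ¬ p ∣ y i) {x : R} (hx : x ≠ 0) :
    ∀ {z : R}, (∀ i, x ∣ y i * z) → x ∣ z := by
  induction x using UniqueFactorizationMonoid.induction_on_prime with
  | h₁ => exact absurd rfl hx
  | h₂ x hu => exact fun _ => hu.dvd
  | h₃ x p _ hp ih =>
    intro z h
    obtain ⟨i, hi⟩ := hy p hp
    obtain ⟨z, rfl⟩ := (hp.dvd_or_dvd ((dvd_mul_right p x).trans (h i))).resolve_left hi
    refine mul_dvd_mul_left p (ih (right_ne_zero_of_mul hx) fun i => ?_)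
    have := h i
    rw [mul_left_comm] at this
    exact (mul_dvd_mul_iff_left hp.ne_zero).mp this

variable {R : Type*} [CommRing R] {n : ℕ}

/-- The square matrix with first row the unit vector `e_k` and remaining rows `g`. Its determinant
is, up to sign, the maximal minor of `g` that omits column `k`. -/
def borderedMatrix (g : Fin n → Fin (n + 1) → R) (k : Fin (n + 1)) :
    Matrix (Fin (n + 1)) (Fin (n + 1)) R :=
  Matrix.of (Fin.cons (Pi.single k 1) g)

variable {g : Fin n → Fin (n + 1) → R} {f : Fin (n + 1) → R}

lemma borderedMatrix_zero (k i : Fin (n + 1)) :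
    borderedMatrix g k 0 i = (Pi.single k 1 : Fin (n + 1) → R) i := rfl

lemma borderedMatrix_succ (k i : Fin (n + 1)) (j : Fin n) :
    borderedMatrix g k j.succ i = g j i := rfl

/-- The first column of the adjugate consists of the signed maximal minors of `g`, independently of
the unit vector chosen for the first row. -/
lemma adjugate_borderedMatrix_zero (k i : Fin (n + 1)) :
    (borderedMatrix g k).adjugate i 0 = (borderedMatrix g i).det := by
  rw [Matrix.adjugate_apply]
  congr 1
  ext j l
  refine Fin.cases ?_ (fun j => ?_) j
  · simp [borderedMatrix_zero]
  · rw [Matrix.updateRow_ne (Fin.succ_ne_zero j)]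
    rfl

/-- The vector of signed maximal minors is proportional to `f`. -/
lemma det_borderedMatrix_mul (hg : ∀ j, ∑ i, g j i * f i = 0) (i k : Fin (n + 1)) :
    (borderedMatrix g i).det * f k = (borderedMatrix g k).det * f i := by
  have h1 : (borderedMatrix g k).mulVec f = Pi.single 0 (f k) := by
    ext j
    refine Fin.cases ?_ (fun j => ?_) j
    · simp [Matrix.mulVec, dotProduct, borderedMatrix_zero, Pi.single_apply]
    · simp [Matrix.mulVec, dotProduct, borderedMatrix_succ, hg]
  have h2 := congrArg (fun v => (borderedMatrix g k).adjugate.mulVec v i) h1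
  simp only [Matrix.mulVec_mulVec, Matrix.adjugate_mul, Matrix.smul_mulVec, Matrix.one_mulVec,
    Pi.smul_apply, smul_eq_mul, Matrix.mulVec_single] at h2
  rw [h2]
  simp [adjugate_borderedMatrix_zero]

/-- Hilbert–Burch: if the `f_i` have no common prime factor and the rows of `g` form a basis of
their syzygies, then the signed maximal minors of `g` are the `f_i` up to a common unit. They are
`c f_i` for some `c`; modulo a prime factor of `c` the rows of `g` would become dependent. -/
lemma exists_isUnit_det_borderedMatrix_eq [IsDomain R] [UniqueFactorizationMonoid R]
    (hf0 : ∃ k, f k ≠ 0) (hf : ∀ p, Prime p → ∃ i, ¬ p ∣ f i)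
    (hg : ∀ j, ∑ i, g j i * f i = 0) (hlin : LinearIndependent R g)
    (hspan : ∀ h : Fin (n + 1) → R, ∑ i, h i * f i = 0 → ∃ c : Fin n → R, ∑ j, c j • g j = h) :
    ∃ c, IsUnit c ∧ ∀ k, (borderedMatrix g k).det = c * f k := by
  obtain ⟨k₀, hk₀⟩ := hf0
  rw [Fintype.linearIndependent_iff] at hlin
  -- A left relation `v` of the bordered matrix, paired with `f`.
  have hpair : ∀ (k : Fin (n + 1)) (v : Fin (n + 1) → R),
      ∑ i, (∑ j, v j * borderedMatrix g k j i) * f i = v 0 * f k := by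
    intro k v
    have h1 : ∀ i, (∑ j, v j * borderedMatrix g k j i) * f i =
        v 0 * (Pi.single k 1 : Fin (n + 1) → R) i * f i +
          ∑ j : Fin n, v j.succ * (g j i * f i) := by
      intro i
      rw [Fin.sum_univ_succ, add_mul, Finset.sum_mul]
      simp only [borderedMatrix_zero, borderedMatrix_succ, mul_assoc]
    rw [Finset.sum_congr rfl fun i _ => h1 i, Finset.sum_add_distrib, Finset.sum_comm]
    simp only [← Finset.mul_sum, hg, mul_zero, Finset.sum_const_zero, add_zero]
    simp [Pi.single_apply]
  obtain ⟨c, hc⟩ : f k₀ ∣ (borderedMatrix g k₀).det :=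
    dvd_of_forall_dvd_mul hf hk₀ fun k => by
      rw [mul_comm (f k), ← det_borderedMatrix_mul hg]
      exact dvd_mul_left _ _
  have hcf : ∀ k, (borderedMatrix g k).det = c * f k := by
    intro k
    apply mul_right_cancel₀ hk₀
    rw [det_borderedMatrix_mul hg, hc]
    ring
  refine ⟨c, ?_, hcf⟩
  have hc0 : c ≠ 0 := by
    rintro rfl
    rw [mul_zero] at hc
    obtain ⟨v, hv0, hv⟩ := Matrix.exists_vecMul_eq_zero_iff.mpr hc
    have hv' : ∀ i, ∑ j, v j * borderedMatrix g k₀ j i = 0 := fun i => congrFun hv i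
    have h0 := hpair k₀ v
    simp only [hv', zero_mul, Finset.sum_const_zero] at h0
    have hv00 : v 0 = 0 := (mul_eq_zero.mp h0.symm).resolve_right hk₀
    apply hv0
    have hs := hlin (fun j => v j.succ) (by
      ext i
      have := hv' i
      rw [Fin.sum_univ_succ, hv00, zero_mul, zero_add] at this
      simpa [borderedMatrix_succ] using this)
    ext j
    exact Fin.cases hv00 hs j
  by_contra hu
  obtain ⟨p, hp, c', rfl⟩ : ∃ p, Prime p ∧ p ∣ c := by
    obtain ⟨p, hp, hpc⟩ := WfDvdMonoid.exists_irreducible_factor hu hc0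
    exact ⟨p, hp.prime, hpc⟩
  obtain ⟨k, hk⟩ := hf p hp
  have : (Ideal.span {p}).IsPrime := (Ideal.span_singleton_prime hp.ne_zero).mpr hp
  have hdet : ((Ideal.Quotient.mk (Ideal.span {p})).mapMatrix (borderedMatrix g k)).det = 0 := by
    rw [← RingHom.map_det, hcf, Ideal.Quotient.eq_zero_iff_mem, Ideal.mem_span_singleton, mul_assoc]
    exact dvd_mul_right _ _
  obtain ⟨w, hw0, hw⟩ := Matrix.exists_vecMul_eq_zero_iff.mpr hdet
  choose v hv using fun j => Ideal.Quotient.mk_surjective (w j)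
  have hdvd : ∀ i, p ∣ ∑ j, v j * borderedMatrix g k j i := by
    intro i
    rw [← Ideal.mem_span_singleton, ← Ideal.Quotient.eq_zero_iff_mem, map_sum]
    simp only [map_mul, hv]
    exact congrFun hw i
  choose h hh using hdvd
  have h0 := hpair k v
  simp only [hh] at h0
  obtain ⟨v₀, hv₀⟩ : p ∣ v 0 := by
    refine (hp.dvd_or_dvd (⟨∑ i, h i * f i, ?_⟩ : p ∣ v 0 * f k)).resolve_right hk
    rw [← h0, Finset.mul_sum]
    exact Finset.sum_congr rfl fun i _ => by ring
  have hsyz : ∑ i, (h - v₀ • Pi.single k 1 : Fin (n + 1) → R) i * f i = 0 := by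
    apply mul_left_cancel₀ hp.ne_zero
    have h1 : ∑ i, p * h i * f i = p * ∑ i, h i * f i := by
      rw [Finset.mul_sum]
      exact Finset.sum_congr rfl fun i _ => by ring
    rw [h1, hv₀] at h0
    simp only [Pi.sub_apply, Pi.smul_apply, smul_eq_mul, sub_mul, Finset.sum_sub_distrib, mul_sub,
      h0]
    simp [Pi.single_apply, mul_assoc]
  obtain ⟨u, hu'⟩ := hspan _ hsyz
  have hvu := hlin (fun j => v j.succ - p * u j) (by
    ext i
    have h1 := hh i
    have h2 := congrFun hu' i
    rw [Fin.sum_univ_succ] at h1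
    simp only [borderedMatrix_zero, borderedMatrix_succ, hv₀] at h1
    simp only [Finset.sum_apply, Pi.smul_apply, smul_eq_mul, Pi.sub_apply] at h2
    simp only [sub_smul, Finset.sum_sub_distrib, Pi.sub_apply, Finset.sum_apply, Pi.smul_apply,
      smul_eq_mul, mul_assoc, ← Finset.mul_sum, Pi.zero_apply]
    linear_combination h1 - p * h2)
  apply hw0
  ext j
  rw [← hv, Pi.zero_apply, Ideal.Quotient.eq_zero_iff_mem, Ideal.mem_span_singleton]
  refine Fin.cases ?_ (fun j => ?_) j
  · exact ⟨v₀, hv₀⟩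
  · exact ⟨u j, sub_eq_zero.mp (hvu j)⟩

end HilbertBurch

/-- A nonzero determinant whose entry `(j, i)` is a form of degree `β_j - α_i` is a form of degree
`Σ β - Σ α`. -/
lemma isHomogeneous_det {K ι : Type*} [Field K] [Fintype ι] [DecidableEq ι]
    {M : Matrix ι ι (A K)} {α β : ι → ℕ}
    (hM : ∀ j i, (α i ≤ β j → (M j i).IsHomogeneous (β j - α i)) ∧ (β j < α i → M j i = 0))
    (hdet : M.det ≠ 0) : ∃ N, N + ∑ i, α i = ∑ j, β j ∧ M.det.IsHomogeneous N := by
  have hterm : ∀ σ : Equiv.Perm ι, ∏ i, M (σ i) i = 0 ∨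
      ∑ i, α i ≤ ∑ j, β j ∧ (∏ i, M (σ i) i).IsHomogeneous (∑ j, β j - ∑ i, α i) := by
    intro σ
    by_cases hσ : ∀ i, α i ≤ β (σ i)
    · right
      have h1 : ∑ i, (β (σ i) - α i) + ∑ i, α i = ∑ j, β j := by
        rw [← Finset.sum_add_distrib, ← Equiv.sum_comp σ β]
        exact Finset.sum_congr rfl fun i _ => Nat.sub_add_cancel (hσ i)
      refine ⟨by omega, ?_⟩
      rw [← h1, Nat.add_sub_cancel]
      exact IsHomogeneous.prod _ _ _ fun i _ => (hM (σ i) i).1 (hσ i)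
    · left
      push Not at hσ
      obtain ⟨i, hi⟩ := hσ
      exact Finset.prod_eq_zero (Finset.mem_univ i) ((hM (σ i) i).2 hi)
  have hle : ∑ i, α i ≤ ∑ j, β j := by
    by_contra hlt
    apply hdet
    rw [Matrix.det_apply]
    refine Finset.sum_eq_zero fun σ _ => ?_
    rw [(hterm σ).resolve_right fun h => hlt h.1, smul_zero]
  refine ⟨_, Nat.sub_add_cancel hle, ?_⟩
  rw [Matrix.det_apply']
  refine IsHomogeneous.sum _ _ _ fun σ _ => ?_
  have hs : ((Equiv.Perm.sign σ : ℤ) : A K) = C ((Equiv.Perm.sign σ : ℤ) : K) := by simp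
  rw [hs]
  refine IsHomogeneous.C_mul ?_ _
  rcases hterm σ with h | h
  · rw [h]
    exact isHomogeneous_zero _ _ _
  · exact h.2

/-! ### The linear substitution given by the syzygies -/

section Substitution
variable {R : Type*} [CommRing R]

lemma aeval_C_mul_X {σ : Type*} {F : MvPolynomial σ R} {m : ℕ} (hF : F.IsHomogeneous m) (t : R) :
    aeval (fun i => (C t * X i : MvPolynomial σ R)) F = C (t ^ m) * F := by
  conv_lhs => rw [F.as_sum]
  conv_rhs => rw [F.as_sum]
  rw [map_sum, Finset.mul_sum]
  refine Finset.sum_congr rfl fun s hs => ?_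
  have hdeg : m = ∑ i ∈ s.support, s i := hF.degree_eq_sum_deg_support hs
  rw [aeval_monomial, Finsupp.prod]
  simp only [mul_pow, Finset.prod_mul_distrib, Finset.prod_pow_eq_pow_sum]
  rw [← hdeg, monomial_eq, Finsupp.prod, algebraMap_eq, map_pow]
  ring

lemma homogeneousComponent_aeval {σ τ : Type*} {u : σ → MvPolynomial τ R}
    (hu : ∀ i, (u i).IsHomogeneous 1) (m : ℕ) (F : MvPolynomial σ R) :
    homogeneousComponent m (aeval u F) = aeval u (homogeneousComponent m F) := by
  have hk : ∀ k, (aeval u (homogeneousComponent k F)).IsHomogeneous k := fun k => by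
    have := (homogeneousComponent_isHomogeneous k F).aeval u hu
    rwa [one_mul] at this
  conv_lhs => rw [← sum_homogeneousComponent F, map_sum, map_sum]
  rw [Finset.sum_congr rfl fun k _ => homogeneousComponent_of_mem (m := m) (hk k),
    Finset.sum_ite_eq]
  split_ifs with h
  · rfl
  · rw [homogeneousComponent_eq_zero, map_zero]
    simpa using h

variable {n : ℕ} (g : Fin n → Fin (n + 1) → R) (f : Fin (n + 1) → R)

/-- The linear form `Σ f_i s_i`. -/
noncomputable def linearForm : MvPolynomial (Fin (n + 1)) R := ∑ i, C (f i) * X i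

/-- The substitution `s_i ↦ Σ_j g_{ji} t_j`. -/
noncomputable def syzygySubst : MvPolynomial (Fin (n + 1)) R →ₐ[R] MvPolynomial (Fin n) R :=
  aeval fun i => ∑ j, C (g j i) * X j

variable {g f}

lemma linearForm_ne_zero {k : Fin (n + 1)} (hk : f k ≠ 0) : linearForm f ≠ 0 := by
  intro h
  have := congrArg (coeff (Finsupp.single k 1)) h
  simp [linearForm, coeff_sum, coeff_C_mul, coeff_X, Finsupp.single_left_inj] at this
  exact hk this

lemma isHomogeneous_sum_C_mul_X (i : Fin (n + 1)) :
    (∑ j, C (g j i) * X j : MvPolynomial (Fin n) R).IsHomogeneous 1 :=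
  IsHomogeneous.sum _ _ _ fun _ _ => isHomogeneous_C_mul_X _ _

lemma syzygySubst_linearForm (hg : ∀ j, ∑ i, g j i * f i = 0) :
    syzygySubst g (linearForm f) = 0 := by
  simp only [syzygySubst, linearForm, map_sum, map_mul, aeval_X, aeval_C, algebraMap_eq,
    Finset.mul_sum]
  rw [Finset.sum_comm]
  refine Finset.sum_eq_zero fun j _ => ?_
  have : ∀ i, C (f i) * (C (g j i) * X j) = C (g j i * f i) * (X j : MvPolynomial (Fin n) R) := by
    intro i
    rw [map_mul]
    ring
  simp only [this, ← Finset.sum_mul, ← map_sum, hg, map_zero, zero_mul]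

/-- The adjugate of the bordered matrix inverts the substitution up to the factor `det`, modulo
the linear form `Σ f_i s_i`. -/
lemma linearForm_dvd_C_pow_mul {c : R} (hc : ∀ k, (borderedMatrix g k).det = c * f k)
    {F : MvPolynomial (Fin (n + 1)) R} {m : ℕ} (hF : F.IsHomogeneous m)
    (h0 : syzygySubst g F = 0) (k : Fin (n + 1)) :
    linearForm f ∣ C ((borderedMatrix g k).det ^ m) * F := by
  let ψ : MvPolynomial (Fin n) R →ₐ[R] MvPolynomial (Fin (n + 1)) R :=
    aeval fun j => ∑ i, C ((borderedMatrix g k).adjugate i j.succ) * X i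
  let I : Ideal (MvPolynomial (Fin (n + 1)) R) := Ideal.span {linearForm f}
  have hadj : ∀ i l, ∑ j : Fin n, (borderedMatrix g k).adjugate i j.succ * g j l =
      (if i = l then (borderedMatrix g k).det else 0) - if l = k then c * f i else 0 := by
    intro i l
    have := congrFun (congrFun (Matrix.adjugate_mul (borderedMatrix g k)) i) l
    rw [Matrix.mul_apply, Fin.sum_univ_succ, adjugate_borderedMatrix_zero, hc i] at this
    simp only [borderedMatrix_zero, borderedMatrix_succ, Matrix.smul_apply, Matrix.one_apply,
      smul_eq_mul, mul_ite, mul_one, mul_zero, Pi.single_apply] at this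
    exact eq_sub_of_add_eq' this
  have hX : ∀ l, ψ (syzygySubst g (X l)) =
      C (borderedMatrix g k).det * X l - if l = k then C c * linearForm f else 0 := by
    intro l
    have h1 : ψ (syzygySubst g (X l)) =
        ∑ i, C (∑ j : Fin n, (borderedMatrix g k).adjugate i j.succ * g j l) * X i := by
      simp only [ψ, syzygySubst, aeval_X, map_sum, map_mul, aeval_C, algebraMap_eq,
        Finset.mul_sum, Finset.sum_mul]
      rw [Finset.sum_comm]
      exact Finset.sum_congr rfl fun i _ => Finset.sum_congr rfl fun j _ => by ring
    rw [h1]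
    simp only [hadj, map_sub, sub_mul, Finset.sum_sub_distrib]
    congr 1
    · rw [Finset.sum_eq_single l (fun i _ hi => by simp [hi]) (by simp), if_pos rfl]
    · split_ifs
      · simp only [linearForm, Finset.mul_sum, map_mul, mul_assoc]
      · simp
  have hcomp : ((Ideal.Quotient.mkₐ R I).comp ψ).comp (syzygySubst g) =
      (Ideal.Quotient.mkₐ R I).comp (aeval fun i => C (borderedMatrix g k).det * X i) := by
    apply algHom_ext
    intro l
    simp only [AlgHom.comp_apply, hX, aeval_X, Ideal.Quotient.mkₐ_eq_mk]
    rw [Ideal.Quotient.eq]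
    split_ifs
    · rw [sub_sub_cancel_left]
      exact I.neg_mem (I.mul_mem_left _ (Ideal.mem_span_singleton_self _))
    · simp
  have := DFunLike.congr_fun hcomp F
  simp only [AlgHom.comp_apply, h0, map_zero, aeval_C_mul_X hF, Ideal.Quotient.mkₐ_eq_mk] at this
  rw [← Ideal.mem_span_singleton, ← Ideal.Quotient.eq_zero_iff_mem]
  exact this.symm

/-- No prime of the polynomial ring divides all powers `f_k ^ m`. -/
lemma exists_not_dvd_C_pow [IsDomain R] {ι σ : Type*} {f : ι → R} (hf0 : ∃ k, f k ≠ 0)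
    (hf : ∀ p, Prime p → ∃ i, ¬ p ∣ f i) (m : ℕ) (p : MvPolynomial σ R) (hp : Prime p) :
    ∃ k, ¬ p ∣ C (f k ^ m) := by
  by_contra! h
  have h' : ∀ k, p ∣ C (f k) := fun k => hp.dvd_of_dvd_pow (by rw [← map_pow]; exact h k)
  obtain ⟨k, hk⟩ := hf0
  have hdeg : p.totalDegree = 0 := by
    by_contra hpos
    exact hk (C_eq_zero_of_dvd (Nat.pos_of_ne_zero hpos) (h' k))
  rw [totalDegree_eq_zero_iff_eq_C] at hdeg
  rw [hdeg, prime_C_iff] at hp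
  obtain ⟨i, hi⟩ := hf _ hp
  have := h' i
  rw [hdeg, C_dvd_iff_dvd_coeff] at this
  exact hi (by simpa using this 0)

/-- The kernel of the substitution is generated by the linear form `Σ f_i s_i`. -/
lemma linearForm_dvd [IsDomain R] [UniqueFactorizationMonoid R] (hf0 : ∃ k, f k ≠ 0)
    (hf : ∀ p, Prime p → ∃ i, ¬ p ∣ f i) {c : R} (hcu : IsUnit c)
    (hc : ∀ k, (borderedMatrix g k).det = c * f k)
    {F : MvPolynomial (Fin (n + 1)) R} (h0 : syzygySubst g F = 0) : linearForm f ∣ F := by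
  obtain ⟨k, hk⟩ := hf0
  have hL := linearForm_ne_zero hk
  rw [← sum_homogeneousComponent F]
  refine Finset.dvd_sum fun m _ => ?_
  refine dvd_of_forall_dvd_mul (y := fun k => C ((borderedMatrix g k).det ^ m)) ?_ hL fun k =>
    linearForm_dvd_C_pow_mul hc (homogeneousComponent_isHomogeneous m F) ?_ k
  · refine exists_not_dvd_C_pow ⟨k, ?_⟩ (fun p hp => ?_) m
    · rw [hc]
      exact mul_ne_zero hcu.ne_zero hk
    · obtain ⟨i, hi⟩ := hf p hp
      exact ⟨i, by rwa [hc, hcu.dvd_mul_left]⟩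
  · rw [syzygySubst, ← homogeneousComponent_aeval isHomogeneous_sum_C_mul_X]
    change homogeneousComponent m (syzygySubst g F) = 0
    rw [h0, map_zero]

end Substitution

section ScrollMap
variable {K : Type*} [Field K] {n : ℕ} {a : Fin (n + 1) → ℕ} {b : Fin n → ℕ}

lemma linearForm_mem {f : Fin (n + 1) → A K} (hf : ∀ i, (f i).IsHomogeneous (a i)) :
    linearForm f ∈ scrollRing K a :=
  Subalgebra.sum_mem _ fun i _ => Algebra.subset_adjoin ⟨i, f i, hf i, rfl⟩

/-- If a multiple of the linear form `Σ f_i s_i` lies in `R(a)`, then it is a multiple by an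
element of `R(a)`: the cofactor may be replaced by its part of degree zero for the grading with
`deg x = deg y = 1` and `deg s_i = -a_i`. -/
lemma exists_mem_of_linearForm_mul_mem {f : Fin (n + 1) → A K}
    (hf : ∀ i, (f i).IsHomogeneous (a i)) {G : B K (n + 1)}
    (hG : linearForm f * G ∈ scrollRing K a) :
    ∃ G' ∈ scrollRing K a, linearForm f * G = linearForm f * G' := by
  classical
  let wt : (Fin (n + 1) →₀ ℕ) → ℕ := fun m => ∑ i, m i * a i
  let G' : B K (n + 1) :=
    ∑ m ∈ G.support, monomial m (homogeneousComponent (wt m) (coeff m G))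
  have hG' : ∀ m, coeff m G' = homogeneousComponent (wt m) (coeff m G) := by
    intro m
    simp only [G', coeff_sum, coeff_monomial, Finset.sum_ite_eq']
    split_ifs with h
    · rfl
    · rw [notMem_support_iff.mp h, map_zero]
  have hmul : ∀ (m : Fin (n + 1) →₀ ℕ) (H : B K (n + 1)), coeff m (linearForm f * H) =
      ∑ i, f i * if i ∈ m.support then coeff (m - Finsupp.single i 1) H else 0 := by
    intro m H
    simp only [linearForm, Finset.sum_mul, mul_assoc, coeff_sum, coeff_C_mul, coeff_X_mul']
  refine ⟨G', mem_scrollRing_iff.mpr fun m => ?_, ?_⟩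
  · rw [hG']
    exact homogeneousComponent_isHomogeneous _ _
  · ext1 m
    rw [← homogeneousComponent_eq_self (mem_scrollRing_iff.mp hG m), hmul, hmul, map_sum]
    refine Finset.sum_congr rfl fun i _ => ?_
    split_ifs with hi
    · rw [hG']
      have hwt : wt m = a i + wt (m - Finsupp.single i 1) := by
        have hle : Finsupp.single i 1 ≤ m := by
          rw [Finsupp.single_le_iff]
          have := Finsupp.mem_support_iff.mp hi
          omega
        obtain ⟨m', rfl⟩ := exists_add_of_le hle
        simp [wt, add_mul, Finset.sum_add_distrib, Finsupp.single_apply]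
      change homogeneousComponent (wt m) _ = _
      rw [hwt, homogeneousComponent_mul_left (hf i)]
    · rw [mul_zero, map_zero]

lemma syzygySubst_mem {g : Fin n → Fin (n + 1) → A K}
    (hg : ∀ j, IsHomogeneousVec a (g j) (b j)) {r : B K (n + 1)} (hr : r ∈ scrollRing K a) :
    syzygySubst g r ∈ scrollRing K b := by
  have hle : scrollRing K a ≤
      (scrollRing K b).comap ((syzygySubst g).restrictScalars K) := by
    refine Algebra.adjoin_le ?_
    rintro _ ⟨i, h, hh, rfl⟩
    change syzygySubst g (C h * X i) ∈ scrollRing K b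
    have himg : syzygySubst g (C h * X i) = ∑ j, C (h * g j i) * X j := by
      simp only [syzygySubst, map_mul, aeval_C, aeval_X, algebraMap_eq, Finset.mul_sum, mul_assoc]
    rw [himg]
    refine Subalgebra.sum_mem _ fun j _ => Algebra.subset_adjoin ⟨j, _, ?_, rfl⟩
    rcases le_or_gt (a i) (b j) with hij | hij
    · have := hh.mul ((hg j i).1 hij)
      rwa [Nat.add_sub_cancel' hij] at this
    · rw [(hg j i).2 hij, mul_zero]
      exact isHomogeneous_zero _ _ _
  exact hle hr

/-- The map `R(a) → R(b)` induced by a matrix of forms of degrees `b_j - a_i`. -/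
noncomputable def scrollMap (g : Fin n → Fin (n + 1) → A K)
    (hg : ∀ j, IsHomogeneousVec a (g j) (b j)) : scrollRing K a →ₐ[K] scrollRing K b :=
  (((syzygySubst g).restrictScalars K).comp (scrollRing K a).val).codRestrict (scrollRing K b)
    fun r => syzygySubst_mem hg r.2

lemma coe_scrollMap {g : Fin n → Fin (n + 1) → A K} (hg : ∀ j, IsHomogeneousVec a (g j) (b j))
    (r : scrollRing K a) : (scrollMap g hg r : B K n) = syzygySubst g (r : B K (n + 1)) := rfl

lemma isGraded_scrollMap {g : Fin n → Fin (n + 1) → A K}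
    (hg : ∀ j, IsHomogeneousVec a (g j) (b j)) : IsGraded (scrollMap g hg) := by
  intro m r hr
  have := IsHomogeneous.aeval hr (fun i => ∑ j, C (g j i) * X j) isHomogeneous_sum_C_mul_X
  rwa [one_mul] at this

/-- A graded map to `R(b)` which is onto in degree one is onto. -/
lemma surjective_of_degreeOneMap_surjective {φ : scrollRing K a →ₐ[K] scrollRing K b}
    (hφ : IsGraded φ) (hs : Function.Surjective (degreeOneMap φ)) : Function.Surjective φ := by
  have hle : scrollRing K b ≤ ((scrollRing K b).val.comp φ).range := by
    refine Algebra.adjoin_le ?_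
    rintro _ ⟨j, h, hh, rfl⟩
    have hmem : (C h * X j : B K n) ∈ scrollRing K b := Algebra.subset_adjoin ⟨j, h, hh, rfl⟩
    obtain ⟨c, hc⟩ := hs (coords K b (C h * X j))
    exact ⟨⟨ofCoords K a c, ofCoords_mem c⟩, coords_injOn (SetLike.coe_mem _) hmem
      (hφ 1 _ (ofCoords_isHomogeneous c)) (isHomogeneous_C_mul_X h j) hc⟩
  intro r
  obtain ⟨s, hs⟩ := hle r.2
  exact ⟨s, Subtype.ext hs⟩

/-! ### From syzygies to hyperplane sections -/

lemma isHyperplaneSection_of_occursAsSyzygyDegrees (h : OccursAsSyzygyDegrees K a b) :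
    IsHyperplaneSection K a b := by
  classical
  obtain ⟨f, hf, hheight, g, hg, hlin, hspan⟩ := h
  have hfp : ∀ p, Prime p → ∃ i, ¬ p ∣ f i := fun _ hp =>
    exists_not_dvd_of_height_eq_two hheight hp
  have hf0 : ∃ k, f k ≠ 0 := by
    obtain ⟨k, hk⟩ := hfp _ (X_prime : Prime (X 0 : A K))
    exact ⟨k, fun h0 => hk (h0 ▸ dvd_zero _)⟩
  have hgf : ∀ j, ∑ i, g j i * f i = 0 := by
    intro j
    have : g j ∈ LinearMap.ker (syzygyMap f) := hspan ▸ Submodule.subset_span ⟨j, rfl⟩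
    rwa [LinearMap.mem_ker, syzygyMap_apply] at this
  obtain ⟨c, hcu, hc⟩ := exists_isUnit_det_borderedMatrix_eq hf0 hfp hgf hlin (by
    intro h hh
    have : h ∈ Submodule.span (A K) (Set.range g) := by
      rw [hspan, LinearMap.mem_ker, syzygyMap_apply, hh]
    exact (Submodule.mem_span_range_iff_exists_fun _).mp this)
  -- Comparing degrees of a maximal minor and the corresponding `f_k` gives `Σ a = Σ b`.
  have hsum : ∑ i, a i = ∑ j, b j := by
    obtain ⟨k, hk⟩ := hf0
    have hne : (borderedMatrix g k).det ≠ 0 := by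
      rw [hc]
      exact mul_ne_zero hcu.ne_zero hk
    have hrows : ∀ j, IsHomogeneousVec a (borderedMatrix g k j)
        ((Fin.cons (a k) b : Fin (n + 1) → ℕ) j) := by
      intro j
      refine Fin.cases ?_ (fun j => ?_) j
      · refine isHomogeneousVec_single le_rfl ?_
        rw [Fin.cons_zero, Nat.sub_self]
        exact isHomogeneous_one _ _
      · exact hg j
    obtain ⟨N, hN, hdet⟩ := isHomogeneous_det hrows hne
    obtain ⟨c₀, -, rfl⟩ := isUnit_iff_eq_C_of_isReduced.mp hcu
    have hdet' : (borderedMatrix g k).det.IsHomogeneous (a k) := by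
      rw [hc]
      exact (hf k).C_mul c₀
    have hNk := hdet.inj_right hdet' hne
    rw [Fin.sum_univ_succ (fun j => (Fin.cons (a k) b : Fin (n + 1) → ℕ) j)] at hN
    simp only [Fin.cons_zero, Fin.cons_succ] at hN
    omega
  let L : scrollRing K a := ⟨linearForm f, linearForm_mem hf⟩
  have hL1 : IsHomogeneousElem L 1 :=
    IsHomogeneous.sum _ _ _ fun i _ => isHomogeneous_C_mul_X _ _
  have hL0 : L ≠ 0 := by
    intro h0
    obtain ⟨k, hk⟩ := hf0
    exact linearForm_ne_zero hk (congrArg Subtype.val h0)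
  have hker : RingHom.ker (scrollMap g hg) = Ideal.span {L} := by
    apply le_antisymm
    · intro r hr
      have h0 : syzygySubst g (r : B K (n + 1)) = 0 := by
        rw [← coe_scrollMap hg, RingHom.mem_ker.mp hr, ZeroMemClass.coe_zero]
      obtain ⟨G, hG⟩ := linearForm_dvd hf0 hfp hcu hc h0
      obtain ⟨G', hG'mem, hG'⟩ := exists_mem_of_linearForm_mul_mem hf (hG ▸ r.2)
      rw [Ideal.mem_span_singleton]
      exact ⟨⟨G', hG'mem⟩, Subtype.ext (hG.trans hG')⟩
    · rw [Ideal.span_singleton_le_iff_mem, RingHom.mem_ker]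
      ext1
      rw [coe_scrollMap, ZeroMemClass.coe_zero]
      exact syzygySubst_linearForm hgf
  refine ⟨L, hL0, hL1, scrollMap g hg, isGraded_scrollMap hg, ?_, hker⟩
  refine surjective_of_degreeOneMap_surjective (isGraded_scrollMap hg) ?_
  have hdim := LinearMap.finrank_range_add_finrank_ker (degreeOneMap (scrollMap g hg))
  rw [ker_degreeOneMap (isGraded_scrollMap hg) hL0 hL1 hker,
    Module.finrank_fintype_fun_eq_card, Fintype.card_sigma] at hdim
  simp only [Fintype.card_fin, Finset.sum_add_distrib, Finset.sum_const, Finset.card_univ,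
    smul_eq_mul, mul_one] at hdim
  rw [← LinearMap.range_eq_top]
  apply Submodule.eq_top_of_finrank_eq
  rw [Module.finrank_fintype_fun_eq_card, Fintype.card_sigma]
  simp only [Fintype.card_fin, Finset.sum_add_distrib, Finset.sum_const, Finset.card_univ,
    smul_eq_mul, mul_one]
  omega

end ScrollMap

end RationalScroll

theorem mainTheorem2 (K : Type*) [Field K] (n : ℕ) (a : Fin (n + 1) → ℕ) (b : Fin n → ℕ)
    (ha_pos : ∀ i, 0 < a i) (ha : Monotone a) (hb_pos : ∀ j, 0 < b j) (hb : Monotone b) :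
    (RationalScroll.OccursAsSyzygyDegrees K a b ↔ RationalScroll.NumericalConditions a b) ∧
    (RationalScroll.IsHyperplaneSection K a b ↔ RationalScroll.NumericalConditions a b) := by
  have h13 := RationalScroll.numericalConditions_of_isHyperplaneSection (K := K) ha_pos ha hb
  have h32 := RationalScroll.occursAsSyzygyDegrees_of_numericalConditions (K := K) (b := b) ha_pos
  have h21 := RationalScroll.isHyperplaneSection_of_occursAsSyzygyDegrees (K := K) (a := a) (b := b)
  exact ⟨⟨fun h => h13 (h21 h), h32⟩, ⟨h13, fun h => h21 (h32 h)⟩⟩
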